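/- Two agents share $m$ items by sequential allocation. A picking sequence $P\in\{1,2\}^m$ is given; both agents submit complete strict rankings of the items, and in turn $t=1,\dots,m$ agent $P_t$ receives the highest item in its submitted ranking that has not yet been allocated. The agents have positive additive utilities, given by $u_1(o),u_2(o)>0$ for every item $o$ (ties between items are allowed). Agent 1 commits to a ranking $R$; agent 2 answers with a ranking that maximises its own utility against $R$, and ties between best responses of agent 2 are broken in favour of agent 1. The ranking $R$ is an \emph{optimal Stackelberg strategy} if the resulting utility of agent 1 is the largest possible over all rankings. Theorem. There is an algorithm that, given any $m$, any picking sequence $P\in\{1,2\}^m$ and any positive utilities $u_1,u_2$, computes an optimal Stackelberg strategy for agent 1 in time polynomial in $m$ whenever agent 2 has a constant number of distinct item values. More precisely, for every $k$ there is a polynomial $q_k$ such that the algorithm halts after at most $q_k(m)$ steps with an optimal Stackelberg strategy on every instance with $m$ items in which $u_2$ takes at most $k$ distinct values. Here an algorithm is a program for a random access machine with unit costs, with integer cells (addition, truncated subtraction, comparison, indirect addressing) and real cells for the utilities (copying, addition, comparison). -/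

import Mathlib

namespace SeqAlloc

/-! ### Sequential allocation -/

/-- A ranking (complete strict preference) of the items `Fin m`: `r p` is the item in position `p`,
position `0` being the most preferred one. -/
abbrev Ranking (m : ℕ) := Equiv.Perm (Fin m)

/-- The item of the nonempty set `A` that stands highest in the ranking `r`. -/
def topItem {m : ℕ} (r : Ranking m) (A : Finset (Fin m)) (hA : A.Nonempty) : Fin m :=
  r ((A.image r.symm).min' (hA.image r.symm))

/-- The set of items received by agent `i` when the turns in the list are carried out, starting with
the items of `A` available: the agent whose turn it is gets the highest item of the reported ranking
that has not yet been allocated. -/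
def bundleFrom {n m : ℕ} (prof : Fin n → Ranking m) (i : Fin n) :
    List (Fin n) → Finset (Fin m) → Finset (Fin m)
  | [], _ => ∅
  | a :: turns, A =>
    if hA : A.Nonempty then
      let o := topItem (prof a) A hA
      if a = i then insert o (bundleFrom prof i turns (A.erase o))
      else bundleFrom prof i turns (A.erase o)
    else ∅

/-- The set of items that agent `i` gets under sequential allocation with picking sequence `P`
(agent `P t` has the turn number `t`) and reported profile `prof`. -/
def bundle {n m : ℕ} (P : Fin m → Fin n) (prof : Fin n → Ranking m) (i : Fin n) : Finset (Fin m) :=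
  bundleFrom prof i (List.ofFn P) Finset.univ

/-- Additive utility of a set of items. -/
noncomputable def utility {m : ℕ} (u : Fin m → ℝ) (B : Finset (Fin m)) : ℝ := ∑ o ∈ B, u o

/-! ### Commitment of the first agent.  Agent 1 (leader) is `0 : Fin 2`, agent 2 is `1 : Fin 2`. -/

/-- `S` is a best response of agent 2 to the ranking `R` of agent 1. -/
def IsBestResponse {m : ℕ} (P : Fin m → Fin 2) (u₂ : Fin m → ℝ) (R S : Ranking m) : Prop :=
  ∀ S' : Ranking m, utility u₂ (bundle P ![R, S'] 1) ≤ utility u₂ (bundle P ![R, S] 1)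

/-- `v` is the utility of agent 1 when committing to `R`, if agent 2 best-responds and breaks ties
between best responses in favour of agent 1. -/
def IsLeaderValue {m : ℕ} (P : Fin m → Fin 2) (u₁ u₂ : Fin m → ℝ) (R : Ranking m) (v : ℝ) : Prop :=
  IsGreatest {x | ∃ S, IsBestResponse P u₂ R S ∧ x = utility u₁ (bundle P ![R, S] 0)} v

/-- `R` is an optimal Stackelberg strategy of agent 1. -/
def IsOptimalCommitment {m : ℕ} (P : Fin m → Fin 2) (u₁ u₂ : Fin m → ℝ) (R : Ranking m) : Prop :=
  ∃ v, IsLeaderValue P u₁ u₂ R v ∧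
    ∀ (R' : Ranking m) (v' : ℝ), IsLeaderValue P u₁ u₂ R' v' → v' ≤ v

/-! ### A random access machine with natural and real cells

Programs are `while` programs over numbered arrays of natural numbers and numbered arrays of real
numbers, with computed (indirect) addresses.  Natural numbers can be added, subtracted (truncated)
and compared; multiplication and division are not primitive, so that unit costs do not hide
computation on huge integers.  Real numbers, which hold the utilities, can only be copied, added and
compared.  Each operation costs one step. -/

/-- A memory: the cell with index `j` of the array with name `a` holds `nat a j`
(`real a j` for the arrays of real numbers). -/
structure Store where
  nat : ℕ → ℕ → ℕ
  real : ℕ → ℕ → ℝ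

/-- Expressions for natural numbers. -/
inductive NExp where
  | lit (c : ℕ)
  | cell (a : ℕ) (j : NExp)
  | add (x y : NExp)
  | sub (x y : NExp)

/-- Value of an expression in a memory. -/
def NExp.val (s : Store) : NExp → ℕ
  | lit c => c
  | cell a j => s.nat a (j.val s)
  | add x y => x.val s + y.val s
  | sub x y => x.val s - y.val s

/-- Number of steps of the evaluation of an expression. -/
def NExp.cost : NExp → ℕ
  | lit _ => 1
  | cell _ j => j.cost + 1
  | add x y => x.cost + y.cost + 1
  | sub x y => x.cost + y.cost + 1

/-- Expressions for real numbers. -/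
inductive RExp where
  | cell (a : ℕ) (j : NExp)
  | add (x y : RExp)

/-- Value of a real expression in a memory. -/
noncomputable def RExp.val (s : Store) : RExp → ℝ
  | cell a j => s.real a (j.val s)
  | add x y => x.val s + y.val s

/-- Number of steps of the evaluation of a real expression. -/
def RExp.cost : RExp → ℕ
  | cell _ j => j.cost + 1
  | add x y => x.cost + y.cost + 1

/-- Tests. -/
inductive Test where
  | natLt (x y : NExp)
  | realLt (x y : RExp)
  | neg (b : Test)
  | conj (b c : Test)

/-- Truth of a test in a memory. -/
def Test.Holds (s : Store) : Test → Prop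
  | natLt x y => x.val s < y.val s
  | realLt x y => x.val s < y.val s
  | neg b => ¬ b.Holds s
  | conj b c => b.Holds s ∧ c.Holds s

/-- Number of steps of the evaluation of a test. -/
def Test.cost : Test → ℕ
  | natLt x y => x.cost + y.cost + 1
  | realLt x y => x.cost + y.cost + 1
  | neg b => b.cost + 1
  | conj b c => b.cost + c.cost + 1

/-- Programs. -/
inductive Prog where
  | skip
  | setNat (a : ℕ) (j e : NExp)
  | setReal (a : ℕ) (j : NExp) (e : RExp)
  | seq (p q : Prog)
  | ite (b : Test) (p q : Prog)
  | loop (b : Test) (p : Prog)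

/-- The memory after writing `v` into the cell `j` of the array `a` of natural numbers. -/
def Store.putNat (s : Store) (a j v : ℕ) : Store :=
  { s with nat := Function.update s.nat a (Function.update (s.nat a) j v) }

/-- The memory after writing `v` into the cell `j` of the array `a` of real numbers. -/
noncomputable def Store.putReal (s : Store) (a j : ℕ) (v : ℝ) : Store :=
  { s with real := Function.update s.real a (Function.update (s.real a) j v) }

/-- `Exec p s t s'`: the program `p`, started in the memory `s`, halts after exactly `t` steps with
the memory `s'`.  (Execution is deterministic; a diverging run has no `t` and `s'`.) -/
inductive Exec : Prog → Store → ℕ → Store → Prop where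
  | skip (s : Store) : Exec .skip s 1 s
  | setNat (a : ℕ) (j e : NExp) (s : Store) :
      Exec (.setNat a j e) s (j.cost + e.cost + 1) (s.putNat a (j.val s) (e.val s))
  | setReal (a : ℕ) (j : NExp) (e : RExp) (s : Store) :
      Exec (.setReal a j e) s (j.cost + e.cost + 1) (s.putReal a (j.val s) (e.val s))
  | seq {p q : Prog} {s s' s'' : Store} {t t' : ℕ} :
      Exec p s t s' → Exec q s' t' s'' → Exec (.seq p q) s (t + t') s''
  | iteTrue {b : Test} {p q : Prog} {s s' : Store} {t : ℕ} :
      b.Holds s → Exec p s t s' → Exec (.ite b p q) s (b.cost + t) s'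
  | iteFalse {b : Test} {p q : Prog} {s s' : Store} {t : ℕ} :
      ¬ b.Holds s → Exec q s t s' → Exec (.ite b p q) s (b.cost + t) s'
  | loopDone {b : Test} {p : Prog} {s : Store} :
      ¬ b.Holds s → Exec (.loop b p) s b.cost s
  | loopStep {b : Test} {p : Prog} {s s' s'' : Store} {t t' : ℕ} :
      b.Holds s → Exec p s t s' → Exec (.loop b p) s' t' s'' →
      Exec (.loop b p) s (b.cost + t + t') s''

/-- The initial memory for an instance: the number `m` of items in cell `0` of array `0`, the picking
sequence in array `1` (`0` for agent 1 and `1` for agent 2), the utilities of agents 1 and 2 in the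
real arrays `0` and `1`; all other cells are `0`. -/
noncomputable def inputStore {m : ℕ} (P : Fin m → Fin 2) (u₁ u₂ : Fin m → ℝ) : Store where
  nat a j :=
    if a = 0 ∧ j = 0 then m
    else if a = 1 then (if h : j < m then (P ⟨j, h⟩ : ℕ) else 0)
    else 0
  real a j :=
    if h : j < m then (if a = 0 then u₁ ⟨j, h⟩ else if a = 1 then u₂ ⟨j, h⟩ else 0)
    else 0

/-- The memory `s` shows the ranking `R` as output: cell `p` of the array `2` of natural numbers
holds the item in position `p`. -/
def Outputs {m : ℕ} (s : Store) (R : Ranking m) : Prop :=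
  ∀ p : Fin m, s.nat 2 p = (R p : ℕ)

end SeqAlloc

namespace SeqAlloc

/-! ### The bundles that agent 2 can obtain against a fixed ranking -/

/-- The number of turns of agent 2 among the first `t` turns. -/
def turnsTwo {m : ℕ} (P : Fin m → Fin 2) (t : ℕ) : ℕ := ((List.ofFn P).take t).count 1

/-- The items in the first `t` positions of the ranking `R`. -/
def pref {m : ℕ} (R : Ranking m) (t : ℕ) : Finset (Fin m) :=
  Finset.univ.filter fun x => (R.symm x : ℕ) < t

/-- `B` has as many items as agent 2 has turns, and at most as many of them stand in the first `t`
positions of `R` as agent 2 has turns among the first `t` ones. -/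
def Feasible {m : ℕ} (P : Fin m → Fin 2) (R : Ranking m) (B : Finset (Fin m)) : Prop :=
  B.card = turnsTwo P m ∧ ∀ t, (B ∩ pref R t).card ≤ turnsTwo P t

section Game

variable {m : ℕ}

@[simp] theorem mem_pref {R : Ranking m} {t : ℕ} {x : Fin m} :
    x ∈ pref R t ↔ (R.symm x : ℕ) < t := by simp [pref]

theorem card_pref (R : Ranking m) {t : ℕ} (ht : t ≤ m) : (pref R t).card = t := by
  have : pref R t = (Finset.univ.filter fun i : Fin m => (i : ℕ) < t).map R.toEmbedding := by
    ext x
    simp only [mem_pref, Finset.mem_map_equiv, Finset.mem_filter, Finset.mem_univ, true_and]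
  rw [this, Finset.card_map, Fin.card_filter_val_lt, min_eq_right ht]

theorem topItem_mem (r : Ranking m) (A : Finset (Fin m)) (hA : A.Nonempty) :
    topItem r A hA ∈ A := by
  have h := (A.image r.symm).min'_mem (hA.image r.symm)
  obtain ⟨x, hx, hxe⟩ := Finset.mem_image.1 h
  unfold topItem
  rw [← hxe]
  simpa using hx

theorem symm_topItem_le (r : Ranking m) {A : Finset (Fin m)} (hA : A.Nonempty) {x : Fin m}
    (hx : x ∈ A) : r.symm (topItem r A hA) ≤ r.symm x := by
  unfold topItem
  rw [Equiv.symm_apply_apply]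
  exact Finset.min'_le _ _ (Finset.mem_image_of_mem _ hx)

theorem bundleFrom_subset {n : ℕ} (prof : Fin n → Ranking m) (i : Fin n) (turns : List (Fin n)) :
    ∀ A : Finset (Fin m), bundleFrom prof i turns A ⊆ A := by
  induction turns with
  | nil => intro A; simp [bundleFrom]
  | cons a turns ih =>
    intro A
    unfold bundleFrom
    split_ifs
    · exact Finset.insert_subset (topItem_mem _ _ _) ((ih _).trans (Finset.erase_subset _ _))
    · exact (ih _).trans (Finset.erase_subset _ _)
    · simp

theorem bundleFrom_zero_eq (prof : Fin 2 → Ranking m) (turns : List (Fin 2)) :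
    ∀ A : Finset (Fin m), A.card = turns.length →
      bundleFrom prof 0 turns A = A \ bundleFrom prof 1 turns A := by
  induction turns with
  | nil =>
    intro A hA
    simp only [List.length_nil, Finset.card_eq_zero] at hA
    simp [bundleFrom, hA]
  | cons a turns ih =>
    intro A hc
    have hA : A.Nonempty := by
      rw [← Finset.card_pos, hc]; simp
    have ho := topItem_mem (prof a) A hA
    have h := ih (A.erase (topItem (prof a) A hA)) (by
      rw [Finset.card_erase_of_mem ho, hc]; simp)
    have hs := bundleFrom_subset prof 1 turns (A.erase (topItem (prof a) A hA))
    unfold bundleFrom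
    simp only [hA, dif_pos]
    generalize topItem (prof a) A hA = o at *
    fin_cases a
    · simp only [Fin.zero_eta, if_true, h]
      ext x
      have := @hs x
      by_cases hx : x = o <;> simp_all
    · simp only [Fin.mk_one, if_true, h]
      ext x
      simp only [Fin.isValue, one_ne_zero, ↓reduceIte, Finset.mem_sdiff, Finset.mem_erase,
        Finset.mem_insert]
      tauto

theorem card_bundleFrom_one (prof : Fin 2 → Ranking m) (turns : List (Fin 2)) :
    ∀ A : Finset (Fin m), A.card = turns.length →
      (bundleFrom prof 1 turns A).card = turns.count 1 := by
  induction turns with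
  | nil => intro A _; simp [bundleFrom]
  | cons a turns ih =>
    intro A hc
    have hA : A.Nonempty := by
      rw [← Finset.card_pos, hc]; simp
    have ho := topItem_mem (prof a) A hA
    have h := ih (A.erase (topItem (prof a) A hA)) (by
      rw [Finset.card_erase_of_mem ho, hc]; simp)
    have hs := bundleFrom_subset prof 1 turns (A.erase (topItem (prof a) A hA))
    unfold bundleFrom
    simp only [hA, dif_pos]
    generalize topItem (prof a) A hA = o at *
    fin_cases a
    · simpa using h
    · have : o ∉ bundleFrom prof 1 turns (A.erase o) := fun hx => by simpa using hs hx
      simp [Finset.card_insert_of_notMem this, h]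

/-- When `s` items are gone, the favourite remaining item stands among the first `s + 1`. -/
theorem symm_topItem_le_of_card (R : Ranking m) {A : Finset (Fin m)} (hA : A.Nonempty) {s : ℕ}
    (hs : A.card + s = m) : (R.symm (topItem R A hA) : ℕ) ≤ s := by
  by_contra! hlt
  have hpos := Finset.card_pos.2 hA
  have hsub : A ⊆ (pref R (s + 1))ᶜ := by
    intro x hx
    have := symm_topItem_le R hA hx
    simp only [Finset.mem_compl, mem_pref, not_lt]
    have : (R.symm (topItem R A hA) : ℕ) ≤ R.symm x := this
    omega
  have := Finset.card_le_card hsub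
  rw [Finset.card_compl, card_pref R (by omega), Fintype.card_fin] at this
  omega

/-- When `s` items are gone, the favourite of agent 1 stands among the first `s + 1` positions of
`R`. So each turn of agent 1 up to time `t` takes an item from the first `t` positions, and these
items are lost to agent 2. -/
theorem card_bundleFrom_inter_pref_add_le (R S : Ranking m) (turns : List (Fin 2)) :
    ∀ (A : Finset (Fin m)) (s t : ℕ), A.card = turns.length → A.card + s = m → s ≤ t →
      (bundleFrom ![R, S] 1 turns A ∩ pref R t).card + (turns.take (t - s)).count 0
        ≤ (A ∩ pref R t).card := by
  induction turns with
  | nil => intro A s t _ _ _; simp [bundleFrom]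
  | cons a turns ih =>
    intro A s t hc hs hst
    have hA : A.Nonempty := by
      rw [← Finset.card_pos, hc]; simp
    rcases hst.eq_or_lt with rfl | hst
    · simpa using Finset.card_le_card
        (Finset.inter_subset_inter_right (bundleFrom_subset ![R, S] 1 (a :: turns) A))
    obtain ⟨d, rfl⟩ : ∃ d, t = s + 1 + d := ⟨t - (s + 1), by omega⟩
    have ho := topItem_mem (![R, S] a) A hA
    have hcard := Finset.card_erase_add_one ho
    have h := ih (A.erase (topItem (![R, S] a) A hA)) (s + 1) (s + 1 + d)
      (by simp at hc; omega) (by omega) (by omega)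
    have hs' := bundleFrom_subset ![R, S] 1 turns (A.erase (topItem (![R, S] a) A hA))
    have e1 : s + 1 + d - s = d + 1 := by omega
    have e2 : s + 1 + d - (s + 1) = d := by omega
    rw [e2] at h
    rw [e1, List.take_succ_cons]
    unfold bundleFrom
    simp only [hA, dif_pos]
    have htop : a = 0 → (R.symm (topItem (![R, S] a) A hA) : ℕ) ≤ s := by
      rintro rfl
      exact symm_topItem_le_of_card R hA hs
    generalize topItem (![R, S] a) A hA = o at *
    have hno : o ∉ bundleFrom ![R, S] 1 turns (A.erase o) := fun hx => by simpa using hs' hx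
    have hins : insert o (A.erase o) = A := Finset.insert_erase ho
    fin_cases a
    · have hop : o ∈ pref R (s + 1 + d) := by
        have := htop rfl
        rw [mem_pref]; omega
      have : (A ∩ pref R (s + 1 + d)).card = (A.erase o ∩ pref R (s + 1 + d)).card + 1 := by
        rw [← Finset.card_insert_of_notMem (a := o) (by simp), ← Finset.insert_inter_of_mem hop, hins]
      simp [-Finset.erase_inter] at h ⊢
      omega
    · by_cases hop : o ∈ pref R (s + 1 + d)
      · have : (A ∩ pref R (s + 1 + d)).card = (A.erase o ∩ pref R (s + 1 + d)).card + 1 := by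
          rw [← Finset.card_insert_of_notMem (a := o) (by simp), ← Finset.insert_inter_of_mem hop,
            hins]
        have h2 := Finset.card_insert_of_notMem (a := o)
          (s := bundleFrom ![R, S] 1 turns (A.erase o) ∩ pref R (s + 1 + d))
          (fun hx => hno (Finset.mem_inter.1 hx).1)
        rw [← Finset.insert_inter_of_mem hop] at h2
        simp [-Finset.erase_inter] at h h2 ⊢
        omega
      · have : A ∩ pref R (s + 1 + d) = A.erase o ∩ pref R (s + 1 + d) := by
          rw [Finset.erase_inter, Finset.erase_eq_of_notMem (by simp [hop])]
        rw [this]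
        simpa [Finset.insert_inter_of_notMem hop, -Finset.erase_inter] using h

theorem count_zero_add_turnsTwo (P : Fin m → Fin 2) {t : ℕ} (ht : t ≤ m) :
    ((List.ofFn P).take t).count 0 + turnsTwo P t = t := by
  have key : ∀ l : List (Fin 2), l.count 0 + l.count 1 = l.length := by
    intro l
    induction l with
    | nil => rfl
    | cons a l ih => fin_cases a <;> simp <;> omega
  have := key ((List.ofFn P).take t)
  simpa [turnsTwo, ht] using this

theorem feasible_bundle (P : Fin m → Fin 2) (R S : Ranking m) :
    Feasible P R (bundle P ![R, S] 1) := by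
  refine ⟨?_, fun t => ?_⟩
  · rw [bundle, card_bundleFrom_one _ _ _ (by simp), turnsTwo, List.take_of_length_le (by simp)]
  · have hle : ∀ t ≤ m, (bundle P ![R, S] 1 ∩ pref R t).card ≤ turnsTwo P t := by
      intro t ht
      have h := card_bundleFrom_inter_pref_add_le R S (List.ofFn P) Finset.univ 0 t (by simp)
        (by simp) (Nat.zero_le _)
      rw [Finset.univ_inter, card_pref R ht, Nat.sub_zero] at h
      have := count_zero_add_turnsTwo P ht
      unfold bundle
      omega
    rcases le_total t m with ht | ht
    · exact hle t ht
    · have e1 : pref R t = pref R m := by ext x; simp; omega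
      have e2 : turnsTwo P t = turnsTwo P m := by
        rw [turnsTwo, turnsTwo, List.take_of_length_le (by simpa), List.take_of_length_le (by simp)]
      rw [e1, e2]
      exact hle m le_rfl

theorem exists_ranking_le_iff {α : Type*} [LinearOrder α] (g : Fin m → α)
    (hg : Function.Injective g) : ∃ S : Ranking m, ∀ x y, S.symm x ≤ S.symm y ↔ g x ≤ g y := by
  refine ⟨Tuple.sort g, fun x y => ?_⟩
  have h : StrictMono (g ∘ Tuple.sort g) :=
    (Tuple.monotone_sort g).strictMono_of_injective (hg.comp (Tuple.sort g).injective)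
  simpa using (h.le_iff_le (a := (Tuple.sort g).symm x) (b := (Tuple.sort g).symm y)).symm

/-- Agent 2 asks for `B` first, in the order of `R`. At a turn of agent 1 after `s` removals, the
prefix condition for `s + 1` says that no remaining item of `B` stands among the first `s + 1`
positions, while the item that agent 1 takes does; so agent 1 never takes from `B`. -/
theorem bundleFrom_eq_inter (R S : Ranking m) (B : Finset (Fin m))
    (hS : ∀ x ∈ B, ∀ y, S.symm y ≤ S.symm x → y ∈ B ∧ R.symm y ≤ R.symm x)
    (turns : List (Fin 2)) :
    ∀ (A : Finset (Fin m)) (s : ℕ), A.card = turns.length → A.card + s = m →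
      (B ∩ A).card = turns.count 1 →
      (∀ t, s ≤ t → (B ∩ A ∩ pref R t).card ≤ (turns.take (t - s)).count 1) →
      bundleFrom ![R, S] 1 turns A = B ∩ A := by
  induction turns with
  | nil =>
    intro A s hc _ _ _
    simp only [List.length_nil, Finset.card_eq_zero] at hc
    simp [bundleFrom, hc]
  | cons a turns ih =>
    intro A s hc hs hB hF
    have hA : A.Nonempty := by
      rw [← Finset.card_pos, hc]; simp
    have ho := topItem_mem (![R, S] a) A hA
    have hcard := Finset.card_erase_add_one ho
    have hc' : (A.erase (topItem (![R, S] a) A hA)).card = turns.length := by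
      simp at hc; omega
    have h := ih (A.erase (topItem (![R, S] a) A hA)) (s + 1) hc' (by omega)
    have hR : a = 0 → (R.symm (topItem (![R, S] a) A hA) : ℕ) ≤ s := by
      rintro rfl
      exact symm_topItem_le_of_card R hA hs
    have hSle : a = 1 → ∀ x ∈ A, S.symm (topItem (![R, S] a) A hA) ≤ S.symm x := by
      rintro rfl x hx
      exact symm_topItem_le S hA hx
    unfold bundleFrom
    simp only [hA, dif_pos]
    generalize topItem (![R, S] a) A hA = o at *
    have hF' : ∀ d, (B ∩ A ∩ pref R (s + 1 + d)).card
        ≤ ((a :: turns.take d).count 1) := by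
      intro d
      have := hF (s + 1 + d) (by omega)
      rwa [show s + 1 + d - s = d + 1 by omega, List.take_succ_cons] at this
    fin_cases a
    · have hoB : o ∉ B := by
        intro hoB
        have h0 := hF' 0
        have : 0 < (B ∩ A ∩ pref R (s + 1 + 0)).card := by
          refine Finset.card_pos.2 ⟨o, ?_⟩
          have := hR rfl
          simp only [Finset.mem_inter, mem_pref]
          exact ⟨⟨hoB, ho⟩, by omega⟩
        simp at h0 this
        simp [h0] at this
      have e : B ∩ A.erase o = B ∩ A := by
        rw [Finset.inter_erase, Finset.erase_eq_of_notMem (by simp [hoB])]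
      rw [e] at h
      simp only [Fin.zero_eta, zero_ne_one, if_false]
      refine h (by simpa using hB) ?_
      intro t ht
      obtain ⟨d, rfl⟩ : ∃ d, t = s + 1 + d := ⟨t - (s + 1), by omega⟩
      simpa using hF' d
    · have hne : (B ∩ A).Nonempty := by
        rw [← Finset.card_pos, hB]; simp
      obtain ⟨x, hx⟩ := hne
      rw [Finset.mem_inter] at hx
      have hoB : o ∈ B := (hS x hx.1 o (hSle rfl x hx.2)).1
      have hmem : o ∈ B ∩ A := Finset.mem_inter.2 ⟨hoB, ho⟩
      have e : B ∩ A.erase o = (B ∩ A).erase o := Finset.inter_erase _ _ _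
      rw [e] at h
      simp only [Fin.mk_one, if_true]
      rw [h, Finset.insert_erase hmem]
      · rw [Finset.card_erase_of_mem hmem, hB]; simp
      · intro t ht
        obtain ⟨d, rfl⟩ : ∃ d, t = s + 1 + d := ⟨t - (s + 1), by omega⟩
        have h1 := hF' d
        rw [show s + 1 + d - (s + 1) = d by omega, Finset.erase_inter]
        by_cases hp : o ∈ pref R (s + 1 + d)
        · rw [Finset.card_erase_of_mem (Finset.mem_inter.2 ⟨hmem, hp⟩)]
          simp at h1 ⊢
          omega
        -- `o` is the `R`-first item of `B ∩ A`, so a prefix that misses `o` misses all of `B ∩ A`.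
        · have : (B ∩ A ∩ pref R (s + 1 + d)) = ∅ := by
            refine Finset.eq_empty_of_forall_notMem fun y hy => hp ?_
            simp only [Finset.mem_inter] at hy
            have h2 := (hS y hy.1.1 o (hSle rfl y hy.1.2)).2
            have h3 := mem_pref.1 hy.2
            rw [mem_pref]
            exact lt_of_le_of_lt h2 h3
          simp [this]

theorem exists_bundle_eq (P : Fin m → Fin 2) (R : Ranking m) {B : Finset (Fin m)}
    (hB : Feasible P R B) : ∃ S : Ranking m, bundle P ![R, S] 1 = B := by
  -- Adding `m` to the positions outside `B` puts these items behind `B` and keeps the order of `R`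
  -- inside both parts.
  obtain ⟨S, hS⟩ := exists_ranking_le_iff
    (fun x => (R.symm x : ℕ) + if x ∈ B then 0 else m) (by
      intro x y hxy
      have h1 := (R.symm x).isLt
      have h2 := (R.symm y).isLt
      apply R.symm.injective
      apply Fin.ext
      simp only at hxy
      split_ifs at hxy <;> omega)
  refine ⟨S, ?_⟩
  have := bundleFrom_eq_inter R S B ?_ (List.ofFn P) Finset.univ 0 (by simp) (by simp) ?_ ?_
  · simpa [bundle] using this
  · intro x hx y hxy
    rw [hS] at hxy
    have h1 := (R.symm x).isLt
    have h2 := (R.symm y).isLt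
    simp only [hx, if_true] at hxy
    split_ifs at hxy with hy
    · exact ⟨hy, by rw [Fin.le_def]; omega⟩
    · omega
  · rw [Finset.inter_univ, hB.1, turnsTwo, List.take_of_length_le (by simp)]
  · intro t _
    simpa [turnsTwo] using hB.2 t

theorem bundle_zero_eq_compl (P : Fin m → Fin 2) (prof : Fin 2 → Ranking m) :
    bundle P prof 0 = (bundle P prof 1)ᶜ := by
  rw [bundle, bundleFrom_zero_eq _ _ _ (by simp), Finset.compl_eq_univ_sdiff, bundle]

end Game

/-! ### The pool process that computes the best response -/

/-- Items are compared by increasing utility for agent 2, then by decreasing utility for agent 1,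
then by their number. -/
def key {m : ℕ} (u₁ u₂ : Fin m → ℝ) (x : Fin m) : ℝ ×ₗ (ℝᵒᵈ ×ₗ Fin m) :=
  toLex (u₂ x, toLex (OrderDual.toDual (u₁ x), x))

/-- The item of `A` with the smallest key. -/
noncomputable def worst {m : ℕ} (u₁ u₂ : Fin m → ℝ) (A : Finset (Fin m)) (hA : A.Nonempty) :
    Fin m :=
  (A.exists_min_image (key u₁ u₂) hA).choose

/-- The pool after `t` turns: in each turn the next item of `R` enters the pool, and if it is a turn
of agent 1, then the item with the smallest key leaves the pool. -/
noncomputable def poolSet {m : ℕ} (P : Fin m → Fin 2) (u₁ u₂ : Fin m → ℝ) (R : Ranking m) :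
    ℕ → Finset (Fin m)
  | 0 => ∅
  | t + 1 =>
    if h : t < m then
      if P ⟨t, h⟩ = 0 then
        (insert (R ⟨t, h⟩) (poolSet P u₁ u₂ R t)).erase
          (worst u₁ u₂ (insert (R ⟨t, h⟩) (poolSet P u₁ u₂ R t)) (Finset.insert_nonempty _ _))
      else insert (R ⟨t, h⟩) (poolSet P u₁ u₂ R t)
    else poolSet P u₁ u₂ R t

/-- A set of items that contains with each item all items with larger keys. -/
def KeyUpset {m : ℕ} (u₁ u₂ : Fin m → ℝ) (U : Finset (Fin m)) : Prop :=
  ∀ x ∈ U, ∀ y, key u₁ u₂ x ≤ key u₁ u₂ y → y ∈ U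

section Pool

variable {m : ℕ} {P : Fin m → Fin 2} {u₁ u₂ : Fin m → ℝ} {R : Ranking m}

theorem key_le_iff {x y : Fin m} : key u₁ u₂ x ≤ key u₁ u₂ y ↔
    u₂ x < u₂ y ∨ u₂ x = u₂ y ∧ (u₁ y < u₁ x ∨ u₁ x = u₁ y ∧ x ≤ y) := by
  simp [key, Prod.Lex.toLex_le_toLex]

theorem key_injective (u₁ u₂ : Fin m → ℝ) : Function.Injective (key u₁ u₂) := by
  intro x y h
  simpa [key] using congrArg (fun z => (ofLex (ofLex z).2).2) h

theorem worst_mem (A : Finset (Fin m)) (hA : A.Nonempty) : worst u₁ u₂ A hA ∈ A :=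
  (A.exists_min_image (key u₁ u₂) hA).choose_spec.1

theorem key_worst_le {A : Finset (Fin m)} (hA : A.Nonempty) {x : Fin m} (hx : x ∈ A) :
    key u₁ u₂ (worst u₁ u₂ A hA) ≤ key u₁ u₂ x :=
  (A.exists_min_image (key u₁ u₂) hA).choose_spec.2 x hx

theorem eq_worst {A : Finset (Fin m)} (hA : A.Nonempty) {x : Fin m} (hx : x ∈ A)
    (h : ∀ y ∈ A, key u₁ u₂ x ≤ key u₁ u₂ y) : x = worst u₁ u₂ A hA :=
  key_injective u₁ u₂ (le_antisymm (h _ (worst_mem A hA)) (key_worst_le hA hx))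

theorem turnsTwo_succ {t : ℕ} (h : t < m) :
    turnsTwo P (t + 1) = turnsTwo P t + if P ⟨t, h⟩ = 0 then 0 else 1 := by
  unfold turnsTwo
  rw [List.take_add_one, List.count_append]
  have : (List.ofFn P)[t]? = some (P ⟨t, h⟩) := by simp [h]
  rw [this]
  generalize P ⟨t, h⟩ = a
  fin_cases a <;> simp

theorem turnsTwo_mono : Monotone (turnsTwo P) := fun _ _ h =>
  ((List.take_prefix_take_left h).sublist).count_le _

theorem poolSet_succ_subset {t : ℕ} (h : t < m) :
    poolSet P u₁ u₂ R (t + 1) ⊆ insert (R ⟨t, h⟩) (poolSet P u₁ u₂ R t) := by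
  rw [poolSet, dif_pos h]
  split_ifs
  · exact Finset.erase_subset _ _
  · exact subset_rfl

theorem pref_succ {t : ℕ} (h : t < m) : pref R (t + 1) = insert (R ⟨t, h⟩) (pref R t) := by
  ext x
  rw [Finset.mem_insert, mem_pref, mem_pref, Nat.lt_succ_iff_lt_or_eq, or_comm,
    ← Equiv.symm_apply_eq, Fin.ext_iff]

theorem apply_notMem_pref {t : ℕ} (h : t < m) : R ⟨t, h⟩ ∉ pref R t := by simp

theorem pref_self : pref R m = Finset.univ := by ext; simp

theorem poolSet_subset_pref : ∀ t : ℕ, poolSet P u₁ u₂ R t ⊆ pref R t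
  | 0 => by simp [poolSet]
  | t + 1 => by
    have ih := poolSet_subset_pref t
    by_cases h : t < m
    · rw [pref_succ h]
      exact (poolSet_succ_subset h).trans (Finset.insert_subset_insert _ ih)
    · rw [poolSet, dif_neg h]
      refine ih.trans fun x => ?_
      simp only [mem_pref]
      omega

theorem apply_notMem_poolSet {t : ℕ} (h : t < m) : R ⟨t, h⟩ ∉ poolSet P u₁ u₂ R t :=
  fun hx => apply_notMem_pref h (poolSet_subset_pref t hx)

theorem card_poolSet : ∀ {t : ℕ}, t ≤ m → (poolSet P u₁ u₂ R t).card = turnsTwo P t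
  | 0, _ => by simp [poolSet, turnsTwo]
  | t + 1, h => by
    have h : t < m := h
    have ih := card_poolSet h.le
    rw [poolSet, dif_pos h, turnsTwo_succ h]
    split_ifs
    · rw [Finset.card_erase_of_mem (worst_mem _ _),
        Finset.card_insert_of_notMem (apply_notMem_poolSet h), ih]
      simp
    · rw [Finset.card_insert_of_notMem (apply_notMem_poolSet h), ih]

/-- An item can enter the pool only at its own position, so what is left of an earlier prefix was in
the pool already then. With `card_poolSet` this bounds the prefixes of the final pool. -/
theorem poolSet_inter_pref_subset {q t : ℕ} (hqt : q ≤ t) :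
    poolSet P u₁ u₂ R t ∩ pref R q ⊆ poolSet P u₁ u₂ R q := by
  induction t, hqt using Nat.le_induction with
  | base => exact Finset.inter_subset_left
  | succ t hqt ih =>
    by_cases h : t < m
    · intro x hx
      rw [Finset.mem_inter] at hx
      have := poolSet_succ_subset h hx.1
      rcases Finset.mem_insert.1 this with rfl | h'
      · have := mem_pref.1 hx.2
        simp at this
        omega
      · exact ih (Finset.mem_inter.2 ⟨h', hx.2⟩)
    · rwa [poolSet, dif_neg h]

theorem feasible_poolSet : Feasible P R (poolSet P u₁ u₂ R m) := by
  refine ⟨card_poolSet le_rfl, fun t => ?_⟩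
  rcases le_total t m with h | h
  · rw [← card_poolSet (u₁ := u₁) (u₂ := u₂) (R := R) h]
    exact Finset.card_le_card (poolSet_inter_pref_subset h)
  · calc _ ≤ (poolSet P u₁ u₂ R m).card := Finset.card_le_card Finset.inter_subset_left
      _ = turnsTwo P m := card_poolSet le_rfl
      _ ≤ _ := turnsTwo_mono h

/-! ### The min-max formula for the pool -/

/-- Let `q` be the time after the last expulsion of an item of `U`, or `0`. The expelled item had
the smallest key, so the whole pool, with `turnsTwo P q` items, lay in the upset `U`; from then on
every item of `U` that enters stays. -/
theorem exists_card_poolSet_inter {U : Finset (Fin m)} (hU : KeyUpset u₁ u₂ U) :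
    ∀ {t : ℕ}, t ≤ m → ∃ q ≤ t,
      (poolSet P u₁ u₂ R t ∩ U).card = turnsTwo P q + ((pref R t \ pref R q) ∩ U).card
  | 0, _ => ⟨0, le_rfl, by simp [poolSet, turnsTwo]⟩
  | t + 1, h => by
    have h : t < m := h
    obtain ⟨q, hq, ih⟩ := exists_card_poolSet_inter hU h.le
    have hRq : R ⟨t, h⟩ ∉ pref R q := by
      simp only [mem_pref, Equiv.symm_apply_apply, not_lt, hq]
    have e : pref R (t + 1) \ pref R q = insert (R ⟨t, h⟩) (pref R t \ pref R q) := by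
      rw [pref_succ h, Finset.insert_sdiff_of_notMem _ hRq]
    have hn : R ⟨t, h⟩ ∉ pref R t \ pref R q := fun hx =>
      apply_notMem_pref h (Finset.mem_sdiff.1 hx).1
    have hins : (insert (R ⟨t, h⟩) (poolSet P u₁ u₂ R t) ∩ U).card
        = turnsTwo P q + ((pref R (t + 1) \ pref R q) ∩ U).card := by
      rw [e]
      by_cases hx : R ⟨t, h⟩ ∈ U
      · rw [Finset.insert_inter_of_mem hx, Finset.insert_inter_of_mem hx,
          Finset.card_insert_of_notMem, Finset.card_insert_of_notMem, ih, add_assoc]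
        · exact fun h' => hn (Finset.mem_inter.1 h').1
        · exact fun h' => apply_notMem_poolSet h (Finset.mem_inter.1 h').1
      · rw [Finset.insert_inter_of_notMem hx, Finset.insert_inter_of_notMem hx, ih]
    by_cases hP : P ⟨t, h⟩ = 0
    · by_cases hw : worst u₁ u₂ (insert (R ⟨t, h⟩) (poolSet P u₁ u₂ R t))
          (Finset.insert_nonempty _ _) ∈ U
      · refine ⟨t + 1, le_rfl, ?_⟩
        rw [Finset.inter_eq_left.2, card_poolSet h]
        · simp
        · intro x hx
          exact hU _ hw x (key_worst_le _ (poolSet_succ_subset h hx))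
      · refine ⟨q, by omega, ?_⟩
        rw [poolSet, dif_pos h, if_pos hP, Finset.erase_inter, Finset.erase_eq_of_notMem, hins]
        exact fun h' => hw (Finset.mem_inter.1 h').2
    · refine ⟨q, by omega, ?_⟩
      rw [poolSet, dif_pos h, if_neg hP, hins]

/-- The weak half of the min-max formula: an item of `B ∩ U` is among the at most `turnsTwo P q`
items of `B` in the prefix, or it lies in `U` beyond the prefix. `exists_card_poolSet_inter_eq` is
the equality half. -/
theorem Feasible.card_inter_le {B : Finset (Fin m)} (hB : Feasible P R B) (U : Finset (Fin m))
    (q : ℕ) : (B ∩ U).card ≤ turnsTwo P q + (U \ pref R q).card := by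
  have h : B ∩ U ⊆ (B ∩ pref R q) ∪ (U \ pref R q) := by
    intro x
    simp only [Finset.mem_inter, Finset.mem_union, Finset.mem_sdiff]
    tauto
  exact (Finset.card_le_card h).trans
    ((Finset.card_union_le _ _).trans (Nat.add_le_add_right (hB.2 q) _))

theorem exists_card_poolSet_inter_eq {U : Finset (Fin m)} (hU : KeyUpset u₁ u₂ U) :
    ∃ q ≤ m, (poolSet P u₁ u₂ R m ∩ U).card = turnsTwo P q + (U \ pref R q).card := by
  obtain ⟨q, hq, h⟩ := exists_card_poolSet_inter (P := P) (R := R) hU le_rfl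
  refine ⟨q, hq, h.trans ?_⟩
  rw [pref_self]
  congr 2
  ext x
  simp [and_comm]

theorem Feasible.card_inter_le_poolSet {B : Finset (Fin m)} (hB : Feasible P R B)
    {U : Finset (Fin m)} (hU : KeyUpset u₁ u₂ U) :
    (B ∩ U).card ≤ (poolSet P u₁ u₂ R m ∩ U).card := by
  obtain ⟨q, -, h⟩ := exists_card_poolSet_inter_eq (P := P) (R := R) hU
  exact h ▸ hB.card_inter_le U q

/-! ### From counting dominance to utilities -/

/-- Match a largest element of `A` with a largest element of `B` and remove both; the threshold
counts remain comparable. -/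
theorem sum_le_sum_of_card_filter_le {ι : Type*} [DecidableEq ι] (f : ι → ℝ) :
    ∀ (n : ℕ) (A B : Finset ι), A.card = n → B.card = n →
      (∀ θ : ℝ, (A.filter fun x => θ ≤ f x).card ≤ (B.filter fun x => θ ≤ f x).card) →
      ∑ x ∈ A, f x ≤ ∑ x ∈ B, f x
  | 0, A, B, hA, hB, _ => by
    rw [Finset.card_eq_zero] at hA hB
    simp [hA, hB]
  | n + 1, A, B, hA, hB, h => by
    have hA' : A.Nonempty := Finset.card_pos.1 (by omega)
    have hB' : B.Nonempty := Finset.card_pos.1 (by omega)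
    obtain ⟨a, ha, hamax⟩ := A.exists_max_image f hA'
    obtain ⟨b, hb, hbmax⟩ := B.exists_max_image f hB'
    have hab : f a ≤ f b := by
      have h1 : 0 < (A.filter fun x => f a ≤ f x).card :=
        Finset.card_pos.2 ⟨a, Finset.mem_filter.2 ⟨ha, le_rfl⟩⟩
      obtain ⟨y, hy⟩ := Finset.card_pos.1 (h1.trans_le (h (f a)))
      rw [Finset.mem_filter] at hy
      exact hy.2.trans (hbmax y hy.1)
    rw [← Finset.add_sum_erase A f ha, ← Finset.add_sum_erase B f hb]
    refine add_le_add hab (sum_le_sum_of_card_filter_le f n _ _ ?_ ?_ ?_)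
    · rw [Finset.card_erase_of_mem ha, hA]; rfl
    · rw [Finset.card_erase_of_mem hb, hB]; rfl
    · intro θ
      rw [Finset.filter_erase, Finset.filter_erase]
      by_cases hθ : θ ≤ f a
      · rw [Finset.card_erase_of_mem (Finset.mem_filter.2 ⟨ha, hθ⟩),
          Finset.card_erase_of_mem (Finset.mem_filter.2 ⟨hb, hθ.trans hab⟩)]
        exact Nat.sub_le_sub_right (h θ) 1
      · have : A.filter (fun x => θ ≤ f x) = ∅ :=
          Finset.filter_eq_empty_iff.2 fun x hx hle => hθ (hle.trans (hamax x hx))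
        simp [this]

/-- If `B` dominates `A` in all key-upsets, then `B` is lexicographically better. -/
theorem utility_le_of_card_inter_le {A B : Finset (Fin m)} (hc : A.card = B.card)
    (h : ∀ U, KeyUpset u₁ u₂ U → (A ∩ U).card ≤ (B ∩ U).card) :
    utility u₂ A ≤ utility u₂ B ∧
      (utility u₂ A = utility u₂ B → utility u₁ B ≤ utility u₁ A) := by
  have key_mono : ∀ f : Fin m → ℝ, (∀ x y, key u₁ u₂ x ≤ key u₁ u₂ y → f x ≤ f y) →
      utility f A ≤ utility f B := by
    intro f hf
    refine sum_le_sum_of_card_filter_le f _ A B hc rfl fun θ => ?_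
    have := h (Finset.univ.filter fun x => θ ≤ f x) (by
      intro x hx y hxy
      simp only [Finset.mem_filter, Finset.mem_univ, true_and] at hx ⊢
      exact hx.trans (hf x y hxy))
    simpa [Finset.inter_filter] using this
  refine ⟨key_mono u₂ fun x y hxy => ?_, fun heq => ?_⟩
  · rcases key_le_iff.1 hxy with h | h
    · exact h.le
    · exact h.1.le
  -- For large `M` the function `M * u₂ - u₁` is monotone in the key, because only finitely many
  -- pairs have to be respected. Its sums are then comparable, and when the `u₂`-sums agree only the
  -- reversed inequality for `u₁` remains.
  · have hM : ∀ᶠ M : ℝ in Filter.atTop, ∀ x y, u₂ x < u₂ y → u₁ y - u₁ x ≤ M * (u₂ y - u₂ x) := by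
      rw [Filter.eventually_all]; intro x
      rw [Filter.eventually_all]; intro y
      rw [Filter.eventually_imp_distrib_left]
      intro hxy
      have hpos : 0 < u₂ y - u₂ x := sub_pos.2 hxy
      filter_upwards [Filter.eventually_ge_atTop ((u₁ y - u₁ x) / (u₂ y - u₂ x))] with M hM
      rwa [div_le_iff₀ hpos] at hM
    obtain ⟨M, hM⟩ := hM.exists
    have := key_mono (fun x => M * u₂ x - u₁ x) fun x y hxy => by
      rcases key_le_iff.1 hxy with h | ⟨h, h' | h'⟩
      · have := hM x y h
        linarith
      · simp only [h]; linarith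
      · simp only [h, h'.1]; exact le_rfl
    simp only [utility, Finset.sum_sub_distrib, ← Finset.mul_sum] at this heq ⊢
    rw [heq] at this
    linarith

/-- The final pool is itself a possible bundle and dominates every other one in all key-upsets; the
lexicographic comparison of `utility_le_of_card_inter_le` is the tie-breaking rule. -/
theorem isLeaderValue_iff {v : ℝ} :
    IsLeaderValue P u₁ u₂ R v ↔ v = utility u₁ (poolSet P u₁ u₂ R m)ᶜ := by
  have hval : ∀ B : Finset (Fin m), utility u₁ Bᶜ = utility u₁ Finset.univ - utility u₁ B := by
    intro B
    rw [eq_sub_iff_add_eq]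
    exact Finset.sum_compl_add_sum B u₁
  have hbest : ∀ B, Feasible P R B → utility u₂ B ≤ utility u₂ (poolSet P u₁ u₂ R m) ∧
      (utility u₂ B = utility u₂ (poolSet P u₁ u₂ R m) →
        utility u₁ (poolSet P u₁ u₂ R m) ≤ utility u₁ B) := fun B hB =>
    utility_le_of_card_inter_le (by rw [hB.1, card_poolSet le_rfl])
      fun U hU => hB.card_inter_le_poolSet hU
  obtain ⟨S, hS⟩ := exists_bundle_eq P R (feasible_poolSet (P := P) (u₁ := u₁) (u₂ := u₂))
  have hg : IsLeaderValue P u₁ u₂ R (utility u₁ (poolSet P u₁ u₂ R m)ᶜ) := by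
    refine ⟨⟨S, fun S' => ?_, ?_⟩, ?_⟩
    · rw [hS]
      exact (hbest _ (feasible_bundle P R S')).1
    · rw [bundle_zero_eq_compl, hS]
    · rintro x ⟨S', hS', rfl⟩
      have h1 := hbest _ (feasible_bundle P R S')
      have h2 := hS' S
      rw [hS] at h2
      have := h1.2 (le_antisymm h1.1 h2)
      rw [bundle_zero_eq_compl, hval, hval]
      linarith
  exact ⟨fun h => IsGreatest.unique h hg, fun h => h ▸ hg⟩

/-- The utility that agent 1 gets by committing to `R`. -/
noncomputable def leaderValue (P : Fin m → Fin 2) (u₁ u₂ : Fin m → ℝ) (R : Ranking m) : ℝ :=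
  utility u₁ (poolSet P u₁ u₂ R m)ᶜ

theorem isOptimalCommitment_iff : IsOptimalCommitment P u₁ u₂ R ↔
    ∀ R' : Ranking m, leaderValue P u₁ u₂ R' ≤ leaderValue P u₁ u₂ R := by
  simp [IsOptimalCommitment, isLeaderValue_iff, leaderValue]

end Pool

/-! ### Rankings with few runs suffice -/

section Canonical

variable {m : ℕ} {P : Fin m → Fin 2} {u₁ u₂ : Fin m → ℝ}

/-- By `hle` no bound of the min-max formula for a level set of `u₂` drops from `R` to `R'`, and by
`heq` a tight one survives. So both pools meet each level set equally often and are worth the same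
to agent 2. By `hdown` each class of `u₂` is listed by increasing key, which makes the new pool
dominate the old one in all key-upsets; the tie in `u₂` turns this into a gain for agent 1. -/
theorem leaderValue_le_of_canonical {R R' : Ranking m}
    (hdown : ∀ p, ∀ y ∈ pref R' p, ∀ z ∉ pref R' p, u₂ y = u₂ z → key u₁ u₂ y ≤ key u₁ u₂ z)
    (hle : ∀ (θ : ℝ) (p : ℕ), ((Finset.univ.filter fun x => θ ≤ u₂ x) \ pref R p).card ≤
      ((Finset.univ.filter fun x => θ ≤ u₂ x) \ pref R' p).card)
    (heq : ∀ x : Fin m, ∃ q,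
      (poolSet P u₁ u₂ R m ∩ Finset.univ.filter fun y => u₂ x ≤ u₂ y).card =
        turnsTwo P q + ((Finset.univ.filter fun y => u₂ x ≤ u₂ y) \ pref R' q).card) :
    leaderValue P u₁ u₂ R ≤ leaderValue P u₁ u₂ R' := by
  have hS : Feasible P R (poolSet P u₁ u₂ R m) := feasible_poolSet
  have hS' : Feasible P R' (poolSet P u₁ u₂ R' m) := feasible_poolSet
  have hpool := fun U hU => exists_card_poolSet_inter_eq (P := P) (u₁ := u₁) (u₂ := u₂) (R := R')
    (U := U) hU
  unfold leaderValue
  generalize poolSet P u₁ u₂ R m = S at *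
  generalize poolSet P u₁ u₂ R' m = S' at *
  have hc : ∀ U : Finset (Fin m), (∀ x ∈ U, ∀ y, u₂ x ≤ u₂ y → y ∈ U) →
      (S' ∩ U).card = (S ∩ U).card := by
    intro U hU
    rcases U.eq_empty_or_nonempty with rfl | hne
    · simp
    obtain ⟨x, hx, hmin⟩ := U.exists_min_image u₂ hne
    have hUx : U = Finset.univ.filter fun y => u₂ x ≤ u₂ y := by
      ext y
      simp only [Finset.mem_filter, Finset.mem_univ, true_and]
      exact ⟨hmin y, hU x hx y⟩
    have hkey : KeyUpset u₁ u₂ U := by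
      intro y hy z hyz
      refine hU y hy z ?_
      rcases key_le_iff.1 hyz with h | h
      exacts [h.le, h.1.le]
    apply le_antisymm
    · obtain ⟨q, hq⟩ := heq x
      rw [← hUx] at hq
      rw [hq]
      exact hS'.card_inter_le U q
    · obtain ⟨q, -, hq⟩ := hpool U hkey
      rw [hq]
      refine (hS.card_inter_le U q).trans (Nat.add_le_add_left ?_ _)
      rw [hUx]
      exact hle _ q
  have hd : ∀ V, KeyUpset u₁ u₂ V → (S ∩ V).card ≤ (S' ∩ V).card := by
    intro V hV
    rcases V.eq_empty_or_nonempty with rfl | hne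
    · simp
    obtain ⟨x, hx, hmin⟩ := V.exists_min_image u₂ hne
    set U := Finset.univ.filter fun y => u₂ x ≤ u₂ y with hU
    set W := Finset.univ.filter fun y => u₂ x < u₂ y with hW
    have hcU : (S' ∩ U).card = (S ∩ U).card := hc U (by
      intro y hy z hyz
      simp only [hU, Finset.mem_filter, Finset.mem_univ, true_and] at hy ⊢
      exact hy.trans hyz)
    have hcW : (S' ∩ W).card = (S ∩ W).card := hc W (by
      intro y hy z hyz
      simp only [hW, Finset.mem_filter, Finset.mem_univ, true_and] at hy ⊢
      exact hy.trans_le hyz)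
    have hVU : V ⊆ U := fun y hy => by simpa [hU] using hmin y hy
    have hWV : W ⊆ V := by
      intro y hy
      simp only [hW, Finset.mem_filter, Finset.mem_univ, true_and] at hy
      exact hV x hx y (key_le_iff.2 (Or.inl hy))
    obtain ⟨q, -, hq⟩ := hpool V hV
    -- `V` consists of `W` and the upper part of one class. If an item of the lower part stands
    -- beyond `q`, so does all of `V \ W`, and the bound for `W` suffices. Otherwise `V` and `U`
    -- agree beyond `q`, and the bound for `U` suffices.
    by_cases hz : ∃ z ∈ U, z ∉ V ∧ z ∉ pref R' q
    · obtain ⟨z, hzU, hzV, hzp⟩ := hz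
      have hzx : u₂ x = u₂ z := by
        refine le_antisymm (by simpa [hU] using hzU) (not_lt.1 fun h => hzV (hWV ?_))
        simpa [hW] using h
      have hsub : V \ W ∪ W \ pref R' q ⊆ V \ pref R' q := by
        intro y hy
        simp only [Finset.mem_union, Finset.mem_sdiff] at hy ⊢
        rcases hy with ⟨hyV, hyW⟩ | ⟨hyW, hyp⟩
        · refine ⟨hyV, fun hyp => hzV (hV y hyV z (hdown q y hyp z hzp ?_))⟩
          rw [← hzx]
          refine le_antisymm (not_lt.1 fun h => hyW ?_) (hmin y hyV)
          simpa [hW] using h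
        · exact ⟨hWV hyW, hyp⟩
      have h1 := Finset.card_le_card hsub
      rw [Finset.card_union_of_disjoint (by
        rw [Finset.disjoint_left]
        intro y hy hy'
        exact (Finset.mem_sdiff.1 hy).2 (Finset.mem_sdiff.1 hy').1)] at h1
      have h2 := hS'.card_inter_le W q
      have h3 : (S ∩ V).card ≤ (S ∩ W).card + (V \ W).card := by
        refine (Finset.card_le_card fun y hy => ?_).trans (Finset.card_union_le _ _)
        simp only [Finset.mem_union, Finset.mem_sdiff, Finset.mem_inter] at hy ⊢
        tauto
      omega
    · push Not at hz
      have e : V \ pref R' q = U \ pref R' q := by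
        ext y
        simp only [Finset.mem_sdiff]
        constructor
        · rintro ⟨h1, h2⟩
          exact ⟨hVU h1, h2⟩
        · rintro ⟨h1, h2⟩
          exact ⟨by_contra fun h => h2 (hz y h1 h), h2⟩
      rw [hq, e]
      have h1 := hS'.card_inter_le U q
      have h2 : (S ∩ V).card ≤ (S ∩ U).card :=
        Finset.card_le_card (Finset.inter_subset_inter_left hVU)
      omega
  have hcard : S.card = S'.card := by rw [hS.1, hS'.1]
  have h1 := utility_le_of_card_inter_le hcard hd
  have h2 : utility u₂ S' ≤ utility u₂ S := by
    refine sum_le_sum_of_card_filter_le u₂ _ S' S hcard.symm rfl fun θ => ?_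
    have := hc (Finset.univ.filter fun y => θ ≤ u₂ y) (by
      intro y hy z hyz
      simp only [Finset.mem_filter, Finset.mem_univ, true_and] at hy ⊢
      exact hy.trans hyz)
    simpa [Finset.inter_filter] using this.le
  have h3 := h1.2 (le_antisymm h1.1 h2)
  have e1 := Finset.sum_compl_add_sum S u₁
  have e2 := Finset.sum_compl_add_sum S' u₁
  simp only [utility] at h3 ⊢
  linarith

/-! ### Sorting the segments of a word -/

/-- The number of maximal constant segments of a list. -/
noncomputable def numRuns : List ℝ → ℕ
  | [] => 0
  | [_] => 1
  | a :: b :: l => numRuns (b :: l) + if a = b then 0 else 1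

theorem numRuns_append_le (l₁ l₂ : List ℝ) : numRuns (l₁ ++ l₂) ≤ numRuns l₁ + numRuns l₂ := by
  induction l₁ with
  | nil => simp [numRuns]
  | cons a l₁ ih =>
    cases l₁ with
    | nil =>
      cases l₂ with
      | nil => simp [numRuns]
      | cons b l₂ =>
        simp only [List.singleton_append, numRuns]
        split_ifs <;> omega
    | cons b l₁ =>
      simp only [List.cons_append, numRuns] at ih ⊢
      omega

theorem numRuns_le_card {l : List ℝ} (h : l.Pairwise (· ≤ ·)) : numRuns l ≤ l.toFinset.card := by
  induction l with
  | nil => simp [numRuns]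
  | cons a l ih =>
    cases l with
    | nil => simp [numRuns]
    | cons b l =>
      have ih := ih h.of_cons
      rw [numRuns, List.toFinset_cons (a := a)]
      split_ifs with hab
      · exact ih.trans (Finset.card_le_card (Finset.subset_insert _ _))
      · rw [Finset.card_insert_of_notMem]
        · omega
        · intro ha
          rw [List.mem_toFinset] at ha
          have h1 : a ≤ b := List.rel_of_pairwise_cons h (by simp)
          rcases List.mem_cons.1 ha with rfl | ha
          · exact hab rfl
          · exact hab (le_antisymm h1 (List.rel_of_pairwise_cons h.of_cons ha))

/-- Once a sorted prefix contains an entry that is at least `θ`, all later entries are too, so the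
count beyond `p` is as large as it can be. -/
theorem countP_take_le_of_sorted {l l' : List ℝ} (hp : l'.Perm l) (hs : l'.Pairwise (· ≤ ·))
    (θ : ℝ) (p : ℕ) :
    (l'.take p).countP (θ ≤ ·) ≤ (l.take p).countP (θ ≤ ·) := by
  by_cases h : ∃ a ∈ l'.take p, θ ≤ a
  · obtain ⟨a, ha, hθ⟩ := h
    have h1 : (l'.drop p).countP (θ ≤ ·) = (l'.drop p).length := by
      rw [List.countP_eq_length]
      intro b hb
      rw [← List.take_append_drop p l', List.pairwise_append] at hs
      simpa using hθ.trans (hs.2.2 a ha b hb)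
    have h2 := (l.drop p).countP_le_length (p := (θ ≤ ·))
    have h3 := hp.countP_eq (θ ≤ ·)
    have h4 := hp.length_eq
    have e1 : (l'.take p).countP (θ ≤ ·) + (l'.drop p).countP (θ ≤ ·) = l'.countP (θ ≤ ·) := by
      rw [← List.countP_append, List.take_append_drop]
    have e2 : (l.take p).countP (θ ≤ ·) + (l.drop p).countP (θ ≤ ·) = l.countP (θ ≤ ·) := by
      rw [← List.countP_append, List.take_append_drop]
    simp only [List.length_drop] at h1 h2
    omega
  · push Not at h
    rw [List.countP_eq_zero.2]
    · exact Nat.zero_le _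
    · intro a ha
      simpa using h a ha

/-- Sort each of the `C.card + 1` segments between the cuts: prefix counts can only drop inside a
segment and agree at its ends, and a sorted segment has at most `K` runs. The induction splits off
the segment behind the largest cut. -/
theorem exists_segment_sorted (K : ℕ) (C : Finset ℕ) :
    ∀ l : List ℝ, l.toFinset.card ≤ K → ∃ l' : List ℝ, l'.Perm l ∧ numRuns l' ≤ (C.card + 1) * K ∧
      (∀ (θ : ℝ) (p : ℕ), (l'.take p).countP (θ ≤ ·) ≤ (l.take p).countP (θ ≤ ·)) ∧
      ∀ (θ : ℝ), ∀ p ∈ C, (l'.take p).countP (θ ≤ ·) = (l.take p).countP (θ ≤ ·) := by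
  have hsort : ∀ l : List ℝ, l.toFinset.card ≤ K → ∃ l' : List ℝ, l'.Perm l ∧ numRuns l' ≤ K ∧
      (∀ (θ : ℝ) (p : ℕ), (l'.take p).countP (θ ≤ ·) ≤ (l.take p).countP (θ ≤ ·)) := by
    intro l hK
    have hp := List.perm_insertionSort (· ≤ ·) l
    have hs := List.pairwise_insertionSort (· ≤ ·) l
    refine ⟨_, hp, (numRuns_le_card hs).trans ?_, countP_take_le_of_sorted hp hs⟩
    rwa [List.toFinset_eq_of_perm _ _ hp]
  induction C using Finset.induction_on_max with
  | empty =>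
    intro l hK
    obtain ⟨l', h1, h2, h3⟩ := hsort l hK
    exact ⟨l', h1, by simpa using h2, h3, by simp⟩
  | insert a C ha ih =>
    intro l hK
    have hsub1 : (l.take a).toFinset ⊆ l.toFinset := fun x hx => by
      rw [List.mem_toFinset] at hx ⊢; exact List.mem_of_mem_take hx
    have hsub2 : (l.drop a).toFinset ⊆ l.toFinset := fun x hx => by
      rw [List.mem_toFinset] at hx ⊢; exact List.mem_of_mem_drop hx
    obtain ⟨l₁, p₁, r₁, c₁, e₁⟩ := ih (l.take a) ((Finset.card_le_card hsub1).trans hK)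
    obtain ⟨l₂, p₂, r₂, c₂⟩ := hsort (l.drop a) ((Finset.card_le_card hsub2).trans hK)
    have hl := p₁.length_eq
    rw [List.length_take] at hl
    -- A cut may lie beyond the end of the list; prefixes of that length are the whole list, and
    -- only the permutation matters.
    have htake : ∀ p ≤ a, (l₁ ++ l₂).take p = l₁.take p ∨ l.length ≤ p := by
      intro p hp
      by_cases h : l.length ≤ p
      · exact Or.inr h
      · left
        rw [List.take_append_of_le_length (by omega)]
    have hperm : (l₁ ++ l₂).Perm l := by
      have := p₁.append p₂
      rwa [List.take_append_drop] at this
    have hall : ∀ (θ : ℝ) (p : ℕ), l.length ≤ p →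
        ((l₁ ++ l₂).take p).countP (θ ≤ ·) = (l.take p).countP (θ ≤ ·) := by
      intro θ p hp
      rw [List.take_of_length_le hp, List.take_of_length_le (by rwa [hperm.length_eq]),
        hperm.countP_eq]
    have htt : ∀ p ≤ a, (l.take a).take p = l.take p := fun p hp => by
      rw [List.take_take, min_eq_left hp]
    refine ⟨l₁ ++ l₂, hperm, ?_, ?_, ?_⟩
    · refine (numRuns_append_le _ _).trans ?_
      rw [Finset.card_insert_of_notMem fun h => (ha a h).false]
      nlinarith
    · intro θ p
      rcases le_total p a with hp | hp
      · rcases htake p hp with h | h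
        · rw [h, ← htt p hp]
          exact c₁ θ p
        · exact (hall θ p h).le
      · by_cases h : l.length ≤ p
        · exact (hall θ p h).le
        · have hla : l₁.length = a := by omega
          obtain ⟨d, rfl⟩ := Nat.exists_eq_add_of_le hp
          have e1 : (l₁ ++ l₂).take (a + d) = l₁ ++ l₂.take d := by
            conv_lhs => rw [← hla]
            exact List.take_length_add_append d
          have e2 : l.take (a + d) = l.take a ++ (l.drop a).take d := List.take_add
          rw [e1, e2, List.countP_append, List.countP_append, p₁.countP_eq]
          exact Nat.add_le_add_left (c₂ θ d) _
    · intro θ p hp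
      have hpa : p ≤ a := by
        rcases Finset.mem_insert.1 hp with rfl | h
        exacts [le_rfl, (ha p h).le]
      rcases htake p hpa with h | h
      · rw [h]
        rcases Finset.mem_insert.1 hp with rfl | h'
        · rw [List.take_of_length_le (by omega), p₁.countP_eq]
        · rw [← htt p hpa]
          exact e₁ θ p h'
      · exact hall θ p h

/-! ### Decoding a list of items into a ranking -/

/-- The item with the smallest key among those outside `acc` that are worth at least as much as `x`
to agent 2. -/
noncomputable def pick (u₁ u₂ : Fin m → ℝ) (acc : List (Fin m)) (x : Fin m) (h : x ∉ acc) : Fin m :=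
  worst u₁ u₂ (Finset.univ.filter fun y => y ∉ acc ∧ u₂ x ≤ u₂ y) ⟨x, by simp [h]⟩

theorem pick_spec (acc : List (Fin m)) (x : Fin m) (h : x ∉ acc) :
    pick u₁ u₂ acc x h ∉ acc ∧ u₂ x ≤ u₂ (pick u₁ u₂ acc x h) := by
  have := worst_mem (u₁ := u₁) (u₂ := u₂)
    (Finset.univ.filter fun y => y ∉ acc ∧ u₂ x ≤ u₂ y) ⟨x, by simp [h]⟩
  exact (Finset.mem_filter.1 this).2

theorem key_pick_le {acc : List (Fin m)} {x : Fin m} (h : x ∉ acc) {y : Fin m} (hy : y ∉ acc)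
    (hxy : u₂ x ≤ u₂ y) : key u₁ u₂ (pick u₁ u₂ acc x h) ≤ key u₁ u₂ y :=
  key_worst_le _ (by simp [hy, hxy])

/-- `x` itself competes, so the smallest key belongs to an item worth at most `u₂ x`. A lower
threshold thus does the work of an equality test, and `scan` can serve both decoding and evaluation.
-/
theorem apply_pick {acc : List (Fin m)} {x : Fin m} (h : x ∉ acc) :
    u₂ (pick u₁ u₂ acc x h) = u₂ x := by
  refine le_antisymm ?_ (pick_spec acc x h).2
  rcases key_le_iff.1 (key_pick_le (u₁ := u₁) h h le_rfl) with h' | h'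
  exacts [h'.le, h'.1.le]

theorem pick_congr {acc : List (Fin m)} {x y : Fin m} (hx : x ∉ acc) (hy : y ∉ acc)
    (h : u₂ x = u₂ y) : pick u₁ u₂ acc x hx = pick u₁ u₂ acc y hy := by
  unfold pick
  simp only [h]

theorem card_notMem_append_pick_lt {acc : List (Fin m)} {x : Fin m} (h : x ∉ acc) :
    (Finset.univ.filter fun y => y ∉ acc ++ [pick u₁ u₂ acc x h]).card <
      (Finset.univ.filter fun y => y ∉ acc).card := by
  refine Finset.card_lt_card ⟨fun y hy => ?_, fun hsub => ?_⟩
  · simp at hy ⊢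
    exact hy.1
  · have h1 := (pick_spec (u₁ := u₁) (u₂ := u₂) acc x h).1
    have := @hsub (pick u₁ u₂ acc x h) (by simp [h1])
    simp at this

/-- Append the items of the class of `x` in the order of their keys, up to `x`. -/
noncomputable def extend (u₁ u₂ : Fin m → ℝ) (acc : List (Fin m)) (x : Fin m) : List (Fin m) :=
  if h : x ∈ acc then acc else extend u₁ u₂ (acc ++ [pick u₁ u₂ acc x h]) x
termination_by (Finset.univ.filter fun y => y ∉ acc).card
decreasing_by exact card_notMem_append_pick_lt h

theorem extend_of_mem {acc : List (Fin m)} {x : Fin m} (h : x ∈ acc) :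
    extend u₁ u₂ acc x = acc := by
  rw [extend, dif_pos h]

theorem extend_of_notMem {acc : List (Fin m)} {x : Fin m} (h : x ∉ acc) :
    extend u₁ u₂ acc x = extend u₁ u₂ (acc ++ [pick u₁ u₂ acc x h]) x := by
  conv_lhs => rw [extend, dif_neg h]

/-- Carry out `extend` for all items of a list. -/
noncomputable def decode (u₁ u₂ : Fin m → ℝ) (acc xs : List (Fin m)) : List (Fin m) :=
  xs.foldl (extend u₁ u₂) acc

theorem decode_append (acc xs ys : List (Fin m)) :
    decode u₁ u₂ acc (xs ++ ys) = decode u₁ u₂ (decode u₁ u₂ acc xs) ys := List.foldl_append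

theorem decode_of_subset {acc xs : List (Fin m)} (h : ∀ x ∈ xs, x ∈ acc) :
    decode u₁ u₂ acc xs = acc := by
  induction xs with
  | nil => rfl
  | cons x xs ih =>
    rw [decode, List.foldl_cons, extend_of_mem (h x (by simp))]
    exact ih fun y hy => h y (by simp [hy])

/-- A list without repetitions whose prefixes contain with each item the items of the same class with
smaller keys. -/
def Grown (u₁ u₂ : Fin m → ℝ) (acc : List (Fin m)) : Prop :=
  acc.Nodup ∧ ∀ p, ∀ y ∈ acc.take p, ∀ z ∉ acc.take p, u₂ y = u₂ z → key u₁ u₂ y ≤ key u₁ u₂ z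

theorem grown_nil : Grown u₁ u₂ [] := by simp [Grown]

theorem Grown.append_pick {acc : List (Fin m)} (hg : Grown u₁ u₂ acc) {x : Fin m} (h : x ∉ acc) :
    Grown u₁ u₂ (acc ++ [pick u₁ u₂ acc x h]) := by
  refine ⟨?_, fun p y hy z hz hyz => ?_⟩
  · rw [List.nodup_append]
    refine ⟨hg.1, by simp, ?_⟩
    intro a ha b hb
    simp only [List.mem_singleton] at hb
    rintro rfl
    exact (pick_spec acc x h).1 (hb ▸ ha)
  · rcases le_or_gt p acc.length with hp | hp
    · rw [List.take_append_of_le_length hp] at hy hz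
      exact hg.2 p y hy z hz hyz
    · rw [List.take_of_length_le (by simp; omega)] at hy hz
      simp only [List.mem_append, List.mem_singleton, not_or] at hy hz
      rcases hy with hy | rfl
      · refine hg.2 acc.length y (by simpa using hy) z (by simpa using hz.1) hyz
      · exact key_pick_le h hz.1 (by rw [← hyz, apply_pick (u₁ := u₁) (u₂ := u₂)])

theorem extend_induction {Q : List (Fin m) → Prop} {x : Fin m}
    (hQ : ∀ acc (h : x ∉ acc), Q acc → Q (acc ++ [pick u₁ u₂ acc x h])) (acc : List (Fin m))
    (h : Q acc) : Q (extend u₁ u₂ acc x) ∧ x ∈ extend u₁ u₂ acc x := by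
  by_cases hx : x ∈ acc
  · rw [extend_of_mem hx]
    exact ⟨h, hx⟩
  · rw [extend_of_notMem hx]
    exact extend_induction hQ _ (hQ acc hx h)
termination_by (Finset.univ.filter fun y => y ∉ acc).card
decreasing_by exact card_notMem_append_pick_lt hx

theorem Grown.extend {acc : List (Fin m)} (hg : Grown u₁ u₂ acc) (x : Fin m) :
    Grown u₁ u₂ (extend u₁ u₂ acc x) :=
  (extend_induction (fun _ h hg => hg.append_pick h) acc hg).1

theorem Grown.decode {acc : List (Fin m)} (hg : Grown u₁ u₂ acc) (xs : List (Fin m)) :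
    Grown u₁ u₂ (decode u₁ u₂ acc xs) := by
  induction xs generalizing acc with
  | nil => exact hg
  | cons x xs ih => exact ih (hg.extend x)

theorem subset_extend (acc : List (Fin m)) (x : Fin m) : acc ⊆ extend u₁ u₂ acc x :=
  (extend_induction (Q := fun l => acc ⊆ l)
    (fun _ _ h => List.Subset.trans h (List.subset_append_left _ _)) acc (List.Subset.refl _)).1

theorem mem_decode_of_mem {acc : List (Fin m)} {x : Fin m} {xs : List (Fin m)} :
    x ∈ acc ∨ x ∈ xs → x ∈ decode u₁ u₂ acc xs := by
  induction xs generalizing acc with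
  | nil => simp [decode]
  | cons y xs ih =>
    intro h
    refine ih ?_
    rcases h with h | h
    · exact Or.inl (subset_extend acc y h)
    rcases List.mem_cons.1 h with rfl | h
    · exact Or.inl (extend_induction (Q := fun _ => True) (fun _ _ _ => trivial) acc trivial).2
    · exact Or.inr h

theorem exists_ofFn_eq {l : List (Fin m)} (hd : l.Nodup) (hl : ∀ x, x ∈ l) :
    ∃ R : Ranking m, l = List.ofFn R := by
  have hlen : l.length = m := by
    have h1 := List.toFinset_card_of_nodup hd
    have h2 : l.toFinset = Finset.univ := by ext x; simp [hl x]
    rw [h2, Finset.card_univ, Fintype.card_fin] at h1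
    exact h1.symm
  have hinj : Function.Injective fun i : Fin m => l[(i : ℕ)]'(by rw [hlen]; exact i.isLt) := by
    intro i j hij
    exact Fin.ext ((hd.getElem_inj_iff).1 hij)
  refine ⟨Equiv.ofBijective _ (Finite.injective_iff_bijective.1 hinj), ?_⟩
  apply List.ext_getElem
  · simp [hlen]
  · intro i h1 h2
    simp

theorem pref_eq_toFinset (R : Ranking m) (p : ℕ) : pref R p = ((List.ofFn R).take p).toFinset := by
  ext x
  rw [mem_pref, List.mem_toFinset, List.mem_take_iff_getElem]
  constructor
  · intro h
    exact ⟨R.symm x, by simp [h], by simp⟩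
  · rintro ⟨i, hi, rfl⟩
    simp at hi ⊢
    exact hi.1

theorem countP_take_eq (R : Ranking m) (p : ℕ) (θ : ℝ) :
    ((((List.ofFn R).map u₂).take p).countP (θ ≤ ·)) =
      ((Finset.univ.filter fun x => θ ≤ u₂ x) ∩ pref R p).card := by
  have hn : ((List.ofFn R).take p).Nodup :=
    (List.nodup_ofFn.2 R.injective).sublist (List.take_sublist _ _)
  rw [← List.map_take, List.countP_map, List.countP_eq_length_filter,
    ← List.toFinset_card_of_nodup (hn.filter _), pref_eq_toFinset]
  congr 1
  ext x
  simp [and_comm]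

/-! ### Encoding a word of values by one item per run -/

/-- A run is encoded by its last item, since `extend` supplies the earlier items of the run in key
order. The counting hypothesis guarantees that the classes are not exhausted. The clause on the head
of `xs` is what allows a letter to be merged into the run that follows it. -/
theorem exists_decode_eq (W : List ℝ) : ∀ acc : List (Fin m), acc.Nodup →
    (∀ v, W.count v + (acc.map u₂).count v ≤ (Finset.univ.filter fun x => u₂ x = v).card) →
    ∃ xs : List (Fin m), xs.length = numRuns W ∧
      (decode u₁ u₂ acc xs).map u₂ = acc.map u₂ ++ W ∧
      ∀ x ∈ xs.head?, x ∉ acc ∧ u₂ x ∈ W.head? := by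
  induction W with
  | nil => exact fun acc _ _ => ⟨[], by simp [numRuns, decode]⟩
  | cons v W ih =>
    intro acc hd hc
    have hex : ∃ x, x ∉ acc ∧ u₂ x = v := by
      by_contra! hno
      have h1 := hc v
      have h2 : (Finset.univ.filter fun x => u₂ x = v).card ≤ (acc.map u₂).count v := by
        rw [List.count, List.countP_map, List.countP_eq_length_filter,
          ← List.toFinset_card_of_nodup (hd.filter _)]
        refine Finset.card_le_card fun x hx => ?_
        simp only [Finset.mem_filter, Finset.mem_univ, true_and] at hx
        simp only [List.mem_toFinset, List.mem_filter, Function.comp_apply, beq_iff_eq]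
        exact ⟨by_contra fun h => hno x h hx, hx⟩
      simp at h1
      omega
    obtain ⟨x, hx, hxv⟩ := hex
    set b := pick u₁ u₂ acc x hx with hb
    have hba : b ∉ acc := (pick_spec acc x hx).1
    have hbv : u₂ b = v := by rw [hb, apply_pick (u₁ := u₁) (u₂ := u₂), hxv]
    have hpick : ∀ y (hy : y ∉ acc), u₂ y = v → pick u₁ u₂ acc y hy = b := fun y hy hyv =>
      pick_congr hy hx (hyv.trans hxv.symm)
    have hext : extend u₁ u₂ acc b = acc ++ [b] := by
      rw [extend_of_notMem hba, hpick b hba hbv, extend_of_mem (by simp)]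
    obtain ⟨xs, hlen, hmap, hhead⟩ := ih (acc ++ [b]) (by
        rw [List.nodup_append]
        refine ⟨hd, by simp, ?_⟩
        intro a ha c hc
        rw [List.mem_singleton.1 hc]
        rintro rfl
        exact hba ha) (by
      intro w
      have := hc w
      rw [List.map_append, List.count_append]
      rw [List.count_cons] at this
      simp only [List.map_cons, List.map_nil, hbv, List.count_cons, List.count_nil]
      omega)
    have hmap' : (decode u₁ u₂ (acc ++ [b]) xs).map u₂ = acc.map u₂ ++ v :: W := by
      rw [hmap]; simp [hbv]
    have hcons : decode u₁ u₂ acc (b :: xs) = decode u₁ u₂ (acc ++ [b]) xs := by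
      rw [decode, List.foldl_cons, hext]; rfl
    cases W with
    | nil => exact ⟨b :: xs, by simp [hlen, numRuns], by rw [hcons, hmap'], by simp [hba, hbv]⟩
    | cons w W =>
      by_cases hvw : v = w
      · cases xs with
        | nil =>
          exfalso
          have : (decode u₁ u₂ (acc ++ [b]) []) = acc ++ [b] := rfl
          rw [this] at hmap
          simp at hmap
        | cons y ys =>
          obtain ⟨hy, hyw⟩ := hhead y (by simp)
          simp only [List.mem_append, List.mem_singleton, not_or] at hy
          have hyv : u₂ y = v := by
            rw [hvw]; simpa using hyw.symm
          refine ⟨y :: ys, by simp [hlen, numRuns, hvw], ?_, by simp [hy.1, hyv]⟩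
          rw [← hmap', decode, List.foldl_cons, extend_of_notMem hy.1, hpick y hy.1 hyv]
          rfl
      · exact ⟨b :: xs, by simp [hlen, numRuns, hvw], by rw [hcons, hmap'], by simp [hba, hbv]⟩

theorem exists_decode_leaderValue_le (R : Ranking m) : ∃ (xs : List (Fin m)) (R' : Ranking m),
    xs.length ≤ (Finset.univ.image u₂).card * ((Finset.univ.image u₂).card + 1) ∧
      decode u₁ u₂ [] xs = List.ofFn R' ∧
      leaderValue P u₁ u₂ R ≤ leaderValue P u₁ u₂ R' := by
  have hcrit : ∀ θ : ℝ, ∃ q,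
      (poolSet P u₁ u₂ R m ∩ Finset.univ.filter fun y => θ ≤ u₂ y).card =
        turnsTwo P q + ((Finset.univ.filter fun y => θ ≤ u₂ y) \ pref R q).card := by
    intro θ
    obtain ⟨q, -, hq⟩ := exists_card_poolSet_inter_eq (P := P) (u₁ := u₁) (u₂ := u₂) (R := R)
      (U := Finset.univ.filter fun y => θ ≤ u₂ y) (by
        intro x hx y hxy
        simp only [Finset.mem_filter, Finset.mem_univ, true_and] at hx ⊢
        rcases key_le_iff.1 hxy with h | h
        exacts [hx.trans h.le, hx.trans h.1.le])
    exact ⟨q, hq⟩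
  choose crit hcrit using hcrit
  set K := (Finset.univ.image u₂).card with hK
  have hset : ((List.ofFn R).map u₂).toFinset = Finset.univ.image u₂ := by
    ext v
    simp only [List.mem_toFinset, List.mem_map, Finset.mem_image, Finset.mem_univ, true_and,
      List.mem_ofFn]
    constructor
    · rintro ⟨x, -, h⟩
      exact ⟨x, h⟩
    · rintro ⟨x, h⟩
      exact ⟨x, ⟨R.symm x, by simp⟩, h⟩
  -- The cuts are one tight position per value of `u₂`: at most `K` cuts, so at most `K + 1`
  -- segments with at most `K` runs each.
  obtain ⟨W, hperm, hruns, hle, heq⟩ := exists_segment_sorted K ((Finset.univ.image u₂).image crit)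
    ((List.ofFn R).map u₂) (by rw [hset])
  have hcount : ∀ v, W.count v = (Finset.univ.filter fun x => u₂ x = v).card := by
    intro v
    rw [hperm.count_eq, List.count, List.countP_map, List.countP_eq_length_filter,
      ← List.toFinset_card_of_nodup ((List.nodup_ofFn.2 R.injective).filter _)]
    congr 1
    ext x
    simp only [List.mem_toFinset, List.mem_filter, List.mem_ofFn, Function.comp_apply, beq_iff_eq,
      Finset.mem_filter, Finset.mem_univ, true_and, and_iff_right_iff_imp]
    exact fun _ => ⟨R.symm x, by simp⟩
  obtain ⟨xs, hlen, hmap, -⟩ := exists_decode_eq (u₁ := u₁) (u₂ := u₂) W [] (by simp)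
    (fun v => by simp [hcount v])
  have hg : Grown u₁ u₂ (decode u₁ u₂ [] xs) := grown_nil.decode xs
  have hall : ∀ x, x ∈ decode u₁ u₂ [] xs := by
    have h1 : (decode u₁ u₂ [] xs).length = m := by
      have := congrArg List.length hmap
      rw [List.length_map, List.map_nil, List.nil_append, hperm.length_eq] at this
      simpa using this
    have h2 : (decode u₁ u₂ [] xs).toFinset = Finset.univ := by
      rw [← Finset.card_eq_iff_eq_univ, List.toFinset_card_of_nodup hg.1, h1, Fintype.card_fin]
    intro x
    rw [← List.mem_toFinset, h2]
    exact Finset.mem_univ x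
  obtain ⟨R', hR'⟩ := exists_ofFn_eq hg.1 hall
  rw [hR'] at hmap
  rw [List.map_nil, List.nil_append] at hmap
  have hsplit : ∀ (R : Ranking m) (U : Finset (Fin m)) (p : ℕ),
      (U \ pref R p).card + (U ∩ pref R p).card = U.card := fun R U p =>
    Finset.card_sdiff_add_card_inter U (pref R p)
  refine ⟨xs, R', ?_, hR', leaderValue_le_of_canonical ?_ ?_ ?_⟩
  · rw [hlen]
    refine hruns.trans ?_
    rw [mul_comm]
    exact Nat.mul_le_mul_left _ (Nat.add_le_add_right Finset.card_image_le 1)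
  · intro p y hy z hz
    rw [hR'] at hg
    rw [pref_eq_toFinset, List.mem_toFinset] at hy hz
    exact hg.2 p y hy z hz
  · intro θ p
    have h1 := hle θ p
    rw [← hmap, countP_take_eq, countP_take_eq] at h1
    have h2 := hsplit R (Finset.univ.filter fun x => θ ≤ u₂ x) p
    have h3 := hsplit R' (Finset.univ.filter fun x => θ ≤ u₂ x) p
    omega
  · intro x
    refine ⟨crit (u₂ x), (hcrit (u₂ x)).trans ?_⟩
    have h1 := heq (u₂ x) (crit (u₂ x))
      (Finset.mem_image_of_mem _ (Finset.mem_image_of_mem _ (Finset.mem_univ x)))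
    rw [← hmap, countP_take_eq, countP_take_eq] at h1
    have h2 := hsplit R (Finset.univ.filter fun y => u₂ x ≤ u₂ y) (crit (u₂ x))
    have h3 := hsplit R' (Finset.univ.filter fun y => u₂ x ≤ u₂ y) (crit (u₂ x))
    omega

/-- The ranking that a list of items encodes. -/
noncomputable def ranking (u₁ u₂ : Fin m → ℝ) (xs : List (Fin m)) : Ranking m :=
  (exists_ofFn_eq (grown_nil.decode (u₁ := u₁) (u₂ := u₂) (xs ++ List.finRange m)).1
    fun x => mem_decode_of_mem (Or.inr (by simp))).choose

theorem ofFn_ranking (xs : List (Fin m)) :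
    List.ofFn (ranking u₁ u₂ xs) = decode u₁ u₂ [] (xs ++ List.finRange m) :=
  (exists_ofFn_eq (grown_nil.decode (u₁ := u₁) (u₂ := u₂) (xs ++ List.finRange m)).1
    fun x => mem_decode_of_mem (Or.inr (by simp))).choose_spec.symm

/-- All codes can be given the same length `D`: decoding ignores items already placed, so a short
code is padded at the end with an arbitrary item, and appending all items does not alter a complete
ranking. If padding is needed then `D` is positive, so an item exists. -/
theorem exists_leaderValue_le_ranking (R : Ranking m) {D : ℕ}
    (hD : D = (Finset.univ.image u₂).card * ((Finset.univ.image u₂).card + 1)) :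
    ∃ f : Fin D → Fin m,
      leaderValue P u₁ u₂ R ≤ leaderValue P u₁ u₂ (ranking u₁ u₂ (List.ofFn f)) := by
  obtain ⟨xs, R', hlen, hdec, hle⟩ :=
    exists_decode_leaderValue_le (P := P) (u₁ := u₁) (u₂ := u₂) R
  rw [← hD] at hlen
  obtain ⟨ys, hys⟩ : ∃ ys : List (Fin m), (xs ++ ys).length = D := by
    rcases hlen.eq_or_lt with h | h
    · exact ⟨[], by simpa using h⟩
    · have h1 : (Finset.univ.image u₂).card ≠ 0 := by
        intro h0
        rw [h0, Nat.zero_mul] at hD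
        omega
      obtain ⟨v, hv⟩ := Finset.card_ne_zero.1 h1
      obtain ⟨x, -, -⟩ := Finset.mem_image.1 hv
      exact ⟨List.replicate (D - xs.length) x, by simp; omega⟩
  refine ⟨fun i => (xs ++ ys)[(i : ℕ)]'(by rw [hys]; exact i.isLt), hle.trans_eq ?_⟩
  congr 1
  have e : List.ofFn (fun i : Fin D => (xs ++ ys)[(i : ℕ)]'(by rw [hys]; exact i.isLt)) =
      xs ++ ys := by
    apply List.ext_getElem
    · simpa using hys.symm
    · intro i h1 h2
      simp
  have h := ofFn_ranking (u₁ := u₁) (u₂ := u₂) (xs ++ ys)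
  rw [List.append_assoc, decode_append, hdec, decode_of_subset (by simp [R'.surjective _])] at h
  rw [e]
  exact (DFunLike.coe_injective (List.ofFn_injective h)).symm

end Canonical

/-! ### Reasoning about programs -/

/-- The program `p`, started in `s`, halts within `T` steps in a memory that satisfies `Q`. -/
def Runs (p : Prog) (s : Store) (T : ℕ) (Q : Store → Prop) : Prop :=
  ∃ t s', Exec p s t s' ∧ t ≤ T ∧ Q s'

section Logic

variable {p q : Prog} {s : Store} {T T' : ℕ} {Q Q' : Store → Prop} {b : Test}

theorem Runs.mono (h : Runs p s T Q) (hT : T ≤ T') (hQ : ∀ s', Q s' → Q' s') : Runs p s T' Q' := by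
  obtain ⟨t, s', he, ht, hq⟩ := h
  exact ⟨t, s', he, ht.trans hT, hQ _ hq⟩

theorem Runs.of_le (hT : T ≤ T') (h : Runs p s T Q) : Runs p s T' Q := h.mono hT fun _ h => h

theorem Runs.skip (h : Q s) : Runs .skip s 1 Q := ⟨1, s, .skip s, le_rfl, h⟩

theorem Runs.setNat {a : ℕ} {j e : NExp} (h : Q (s.putNat a (j.val s) (e.val s))) :
    Runs (.setNat a j e) s (j.cost + e.cost + 1) Q := ⟨_, _, .setNat a j e s, le_rfl, h⟩

theorem Runs.setReal {a : ℕ} {j : NExp} {e : RExp} (h : Q (s.putReal a (j.val s) (e.val s))) :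
    Runs (.setReal a j e) s (j.cost + e.cost + 1) Q := ⟨_, _, .setReal a j e s, le_rfl, h⟩

theorem Runs.seq (hp : Runs p s T Q') (hq : ∀ s', Q' s' → Runs q s' T' Q) :
    Runs (.seq p q) s (T + T') Q := by
  obtain ⟨t, s', he, ht, h⟩ := hp
  obtain ⟨t', s'', he', ht', h'⟩ := hq s' h
  exact ⟨t + t', s'', .seq he he', Nat.add_le_add ht ht', h'⟩

theorem Runs.setNat_seq {a : ℕ} {j e : NExp} (h : Runs q (s.putNat a (j.val s) (e.val s)) T Q) :
    Runs (.seq (.setNat a j e) q) s (j.cost + e.cost + 1 + T) Q :=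
  Runs.seq (Q' := fun s' => s' = s.putNat a (j.val s) (e.val s)) (Runs.setNat rfl)
    (by rintro _ rfl; exact h)

theorem Runs.setReal_seq {a : ℕ} {j : NExp} {e : RExp}
    (h : Runs q (s.putReal a (j.val s) (e.val s)) T Q) :
    Runs (.seq (.setReal a j e) q) s (j.cost + e.cost + 1 + T) Q :=
  Runs.seq (Q' := fun s' => s' = s.putReal a (j.val s) (e.val s)) (Runs.setReal rfl)
    (by rintro _ rfl; exact h)

theorem Runs.ite (hp : b.Holds s → Runs p s T Q) (hq : ¬ b.Holds s → Runs q s T Q) :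
    Runs (.ite b p q) s (b.cost + T) Q := by
  by_cases hb : b.Holds s
  · obtain ⟨t, s', he, ht, h⟩ := hp hb
    exact ⟨_, s', .iteTrue hb he, Nat.add_le_add_left ht _, h⟩
  · obtain ⟨t, s', he, ht, h⟩ := hq hb
    exact ⟨_, s', .iteFalse hb he, Nat.add_le_add_left ht _, h⟩

/-- A loop with the invariant `I n`, where `n` bounds the number of iterations that are left. -/
theorem Runs.loop {I : ℕ → Store → Prop}
    (h : ∀ n s, I n s → b.Holds s → Runs p s T fun s' => ∃ n' < n, I n' s') (n : ℕ) (s : Store)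
    (hI : I n s) :
    Runs (.loop b p) s (n * (b.cost + T) + b.cost) fun s' => ∃ n' ≤ n, I n' s' ∧ ¬ b.Holds s' := by
  induction n using Nat.strong_induction_on generalizing s with
  | _ n ih =>
    by_cases hb : b.Holds s
    · obtain ⟨t, s', he, ht, n', hn, hI'⟩ := h n s hI hb
      obtain ⟨t', s'', he', ht', n'', hn', hI''⟩ := ih n' hn s' hI'
      refine ⟨_, s'', .loopStep hb he he', ?_, n'', hn'.trans hn.le, hI''⟩
      have : (n' + 1) * (b.cost + T) ≤ n * (b.cost + T) := Nat.mul_le_mul_right _ hn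
      rw [Nat.succ_mul] at this
      omega
    · exact ⟨_, s, .loopDone hb, Nat.le_add_left _ _, n, le_rfl, hI, hb⟩

/-- The scalar variable in cell `0` of array `a`. -/
abbrev NExp.var (a : ℕ) : NExp := .cell a (.lit 0)

/-- The real scalar variable in cell `0` of array `a`. -/
abbrev RExp.var (a : ℕ) : RExp := .cell a (.lit 0)

/-- Assignment to a scalar variable. -/
abbrev Prog.setVar (a : ℕ) (e : NExp) : Prog := .setNat a (.lit 0) e

/-- Assignment to a real scalar variable. -/
abbrev Prog.setRealVar (a : ℕ) (e : RExp) : Prog := .setReal a (.lit 0) e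

/-- Carry out `p` for the values `0, 1, …` of the variable `v`, as long as it is less than `N`. -/
def Prog.forLoop (v : ℕ) (N : NExp) (p : Prog) : Prog :=
  .seq (.setVar v (.lit 0))
    (.loop (.natLt (.var v) N) (.seq p (.setVar v (.add (.var v) (.lit 1)))))

/-- The bound `N` is evaluated anew before each round, so the invariant must fix its value (`hN`).
`I (i + 1)` is demanded of the memory after the increment, which follows the body. -/
theorem Runs.forLoop {v n : ℕ} {N : NExp} {I : ℕ → Store → Prop} (h0 : I 0 (s.putNat v 0 0))
    (hN : ∀ i s, I i s → N.val s = n)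
    (hstep : ∀ i s, i < n → I i s → s.nat v 0 = i →
      Runs p s T fun s' => s'.nat v 0 = i ∧ I (i + 1) (s'.putNat v 0 (i + 1)))
    (hQ : ∀ s, I n s → s.nat v 0 = n → Q s) :
    Runs (.forLoop v N p) s (n * (T + N.cost + 10) + N.cost + 10) Q := by
  refine Runs.of_le ?_ (Runs.setNat_seq (Runs.mono (Runs.loop (T := T + 6)
    (I := fun k s => ∃ i, i + k = n ∧ I i s ∧ s.nat v 0 = i) ?_ n _ ?_) le_rfl ?_))
  · simp only [NExp.cost, Test.cost]
    have : n * (1 + 1 + N.cost + 1 + (T + 6)) ≤ n * (T + N.cost + 10) :=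
      Nat.mul_le_mul_left _ (by omega)
    omega
  · rintro k s ⟨i, hik, hI, hv⟩ hb
    have hlt : i < n := by
      simpa [Test.Holds, NExp.val, hv, hN i s hI] using hb
    refine Runs.seq (T' := 6) (hstep i s hlt hI hv) fun s' hs' => ?_
    refine Runs.of_le ?_ (Runs.setNat ?_)
    · simp [NExp.cost]
    · refine ⟨k - 1, by omega, i + 1, by omega, ?_, ?_⟩
      · simpa [NExp.val, hs'.1] using hs'.2
      · simp [NExp.val, hs'.1, Store.putNat]
  · exact ⟨0, by omega, by simpa [NExp.val] using h0, by simp [NExp.val, Store.putNat]⟩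
  · rintro s' ⟨k, -, ⟨i, hik, hI, hv⟩, hb⟩
    have hge : ¬ i < n := by
      simpa [Test.Holds, NExp.val, hv, hN i s' hI] using hb
    have : i = n := by omega
    subst this
    exact hQ s' hI hv

end Logic

/-! ### Memory updates and frame conditions -/

theorem Store.putNat_real (s : Store) (a j v : ℕ) : (s.putNat a j v).real = s.real := rfl

theorem Store.putReal_nat (s : Store) (a j : ℕ) (v : ℝ) : (s.putReal a j v).nat = s.nat := rfl

theorem Store.putNat_nat_self (s : Store) (a j v : ℕ) :
    (s.putNat a j v).nat a = Function.update (s.nat a) j v := by simp [Store.putNat]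

theorem Store.putNat_nat_of_ne (s : Store) {a b : ℕ} (j v : ℕ) (h : b ≠ a) :
    (s.putNat a j v).nat b = s.nat b := by simp [Store.putNat, h]

theorem Store.putReal_real_self (s : Store) (a j : ℕ) (v : ℝ) :
    (s.putReal a j v).real a = Function.update (s.real a) j v := by simp [Store.putReal]

theorem Store.putReal_real_of_ne (s : Store) {a b : ℕ} (j : ℕ) (v : ℝ) (h : b ≠ a) :
    (s.putReal a j v).real b = s.real b := by simp [Store.putReal, h]

attribute [simp] Store.putNat_real Store.putReal_nat Store.putNat_nat_self Store.putNat_nat_of_ne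
  Store.putReal_real_self Store.putReal_real_of_ne

/-- Only the arrays of natural numbers in `N` and the arrays of real numbers in `L` differ. -/
def Same (N L : List ℕ) (s s' : Store) : Prop :=
  (∀ a ∉ N, s'.nat a = s.nat a) ∧ ∀ a ∉ L, s'.real a = s.real a

theorem Same.refl (N L : List ℕ) (s : Store) : Same N L s s := ⟨fun _ _ => rfl, fun _ _ => rfl⟩

theorem Same.trans {N L N' L' : List ℕ} {s s' s'' : Store} (h : Same N L s s')
    (h' : Same N' L' s' s'') (hN : N' ⊆ N) (hL : L' ⊆ L) : Same N L s s'' :=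
  ⟨fun a ha => by rw [h'.1 a fun h => ha (hN h), h.1 a ha],
    fun a ha => by rw [h'.2 a fun h => ha (hL h), h.2 a ha]⟩

theorem Same.putNat {N L : List ℕ} {s s' : Store} (h : Same N L s s') {a : ℕ} (j v : ℕ)
    (ha : a ∈ N) : Same N L s (s'.putNat a j v) :=
  ⟨fun b hb => by
    have hne : b ≠ a := fun e => hb (e ▸ ha)
    rw [Store.putNat_nat_of_ne _ _ _ hne, h.1 b hb], h.2⟩

theorem Same.putReal {N L : List ℕ} {s s' : Store} (h : Same N L s s') {a : ℕ} (j : ℕ) (v : ℝ)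
    (ha : a ∈ L) : Same N L s (s'.putReal a j v) :=
  ⟨h.1, fun b hb => by
    have hne : b ≠ a := fun e => hb (e ▸ ha)
    rw [Store.putReal_real_of_ne _ _ _ hne, h.2 b hb]⟩

/-- The arrays of the input are unchanged, and so is the real array `4`, which holds zeros. -/
structure Input {m : ℕ} (P : Fin m → Fin 2) (u₁ u₂ : Fin m → ℝ) (s : Store) : Prop where
  size : s.nat 0 0 = m
  turn : ∀ i : Fin m, s.nat 1 i = (P i : ℕ)
  util₁ : ∀ i : Fin m, s.real 0 i = u₁ i
  util₂ : ∀ i : Fin m, s.real 1 i = u₂ i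
  zero : s.real 4 0 = 0

theorem Input.of_same {m : ℕ} {P : Fin m → Fin 2} {u₁ u₂ : Fin m → ℝ} {s s' : Store}
    (hi : Input P u₁ u₂ s) {N L : List ℕ} (h : Same N L s s')
    (hN : 0 ∉ N ∧ 1 ∉ N) (hL : 0 ∉ L ∧ 1 ∉ L ∧ 4 ∉ L) : Input P u₁ u₂ s' :=
  ⟨by rw [h.1 0 hN.1, hi.size], by rw [h.1 1 hN.2]; exact hi.turn,
    by rw [h.2 0 hL.1]; exact hi.util₁, by rw [h.2 1 hL.2.1]; exact hi.util₂,
    by rw [h.2 4 hL.2.2, hi.zero]⟩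

/-! ### The item with the smallest key -/

/-- Put into variable `13` the item with the smallest key among the items that are marked in array
`F` and that have utility at least the real variable `5` for agent 2.  Variable `14` is the loop
variable. -/
def scan (F : ℕ) : Prog :=
  .seq (.setVar 13 (.var 0)) <| .forLoop 14 (.var 0) <|
    .ite (.conj (.natLt (.lit 0) (.cell F (.var 14))) <|
        .conj (.neg (.realLt (.cell 1 (.var 14)) (.var 5))) <|
        .neg <| .conj (.natLt (.var 13) (.var 0)) <|
          .conj (.neg (.realLt (.cell 1 (.var 14)) (.cell 1 (.var 13)))) <|
            .neg <| .conj (.neg (.realLt (.cell 1 (.var 13)) (.cell 1 (.var 14))))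
              (.realLt (.cell 0 (.var 13)) (.cell 0 (.var 14))))
      (.setVar 13 (.var 14)) .skip

theorem key_le_of_better {m : ℕ} {u₁ u₂ : Fin m → ℝ} {b y : Fin m}
    (h : ¬ (¬ u₂ y < u₂ b ∧ ¬ (¬ u₂ b < u₂ y ∧ u₁ b < u₁ y))) : key u₁ u₂ y ≤ key u₁ u₂ b := by
  rw [key_le_iff]
  rcases lt_trichotomy (u₂ y) (u₂ b) with h' | h' | h'
  · exact Or.inl h'
  · simp only [h', lt_self_iff_false, not_false_eq_true, true_and, not_not] at h
    exact Or.inr ⟨h', Or.inl h⟩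
  · simp [h', h'.le] at h

/-- The test of `scan` compares utilities only and replaces the candidate only by a strictly better
item. As items are visited by increasing number, `b ≤ y` settles ties as the key demands. -/
theorem key_le_of_not_better {m : ℕ} {u₁ u₂ : Fin m → ℝ} {b y : Fin m} (hby : b ≤ y)
    (h : ¬ u₂ y < u₂ b ∧ ¬ (¬ u₂ b < u₂ y ∧ u₁ b < u₁ y)) : key u₁ u₂ b ≤ key u₁ u₂ y := by
  rw [key_le_iff]
  rcases lt_trichotomy (u₂ b) (u₂ y) with h' | h' | h'
  · exact Or.inl h'
  · simp only [h', lt_self_iff_false, not_false_eq_true, true_and, not_lt] at h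
    rcases h.eq_or_lt with h'' | h''
    · exact Or.inr ⟨h', Or.inr ⟨h''.symm, hby⟩⟩
    · exact Or.inr ⟨h', Or.inl h''⟩
  · exact absurd h' h.1

theorem runs_scan {m : ℕ} {P : Fin m → Fin 2} {u₁ u₂ : Fin m → ℝ} {s : Store}
    (hs : Input P u₁ u₂ s) {F : ℕ} (hF13 : F ≠ 13) (hF14 : F ≠ 14) {A : Finset (Fin m)}
    (hA : A.Nonempty) (hmem : ∀ y : Fin m, y ∈ A ↔ 0 < s.nat F y ∧ s.real 5 0 ≤ u₂ y) :
    Runs (scan F) s (100 * m + 100) fun s' =>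
      s'.nat 13 0 = (worst u₁ u₂ A hA : ℕ) ∧ Same [13, 14] [] s s' := by
  refine Runs.of_le ?_ (Runs.setNat_seq (Runs.forLoop (n := m) (T := 70)
    (I := fun i s' => s'.real = s.real ∧ (∀ a, a ≠ 13 → a ≠ 14 → s'.nat a = s.nat a) ∧
      -- The value `m`, which is no item, means that no item of `A` has been met yet.
      ((s'.nat 13 0 = m ∧ ∀ y ∈ A, ¬ (y : ℕ) < i) ∨
        ∃ b ∈ A, (b : ℕ) < i ∧ s'.nat 13 0 = b ∧
          ∀ y ∈ A, (y : ℕ) < i → key u₁ u₂ b ≤ key u₁ u₂ y)) ?_ ?_ ?_ ?_))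
  · simp only [NExp.cost]
    omega
  · refine ⟨rfl, fun a h1 h2 => by simp [h1, h2], Or.inl ⟨?_, by simp⟩⟩
    simp [NExp.val, hs.size]
  · rintro i s' ⟨-, hn, -⟩
    simp [NExp.val, hn 0, hs.size]
  · rintro i s' hi ⟨hr, hn, hb⟩ hv
    have e0 : s'.nat 0 0 = m := by rw [hn 0 (by decide) (by decide), hs.size]
    have eF : s'.nat F = s.nat F := hn F hF13 hF14
    have hu₁ : ∀ x : Fin m, s'.real 0 x = u₁ x := by rw [hr]; exact hs.util₁
    have hu₂ : ∀ x : Fin m, s'.real 1 x = u₂ x := by rw [hr]; exact hs.util₂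
    have r5 : s'.real 5 = s.real 5 := by rw [hr]
    have hiu₁ := hu₁ ⟨i, hi⟩
    have hiu₂ := hu₂ ⟨i, hi⟩
    have hmi := hmem ⟨i, hi⟩
    simp only at hiu₁ hiu₂ hmi
    refine Runs.of_le ?_ (Runs.ite (T := 10) (fun hc => ?_) fun hc => ?_)
    · simp [Test.cost, NExp.cost, RExp.cost]
    · refine Runs.of_le ?_ (Runs.setNat ?_)
      · simp [NExp.cost]
      refine ⟨by simpa [NExp.val] using hv, hr, fun a h1 h2 => by simp [h1, h2, hn], Or.inr ?_⟩
      simp only [Test.Holds, NExp.val, RExp.val, hv, e0, eF, r5, hiu₁, hiu₂] at hc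
      have hiA : ⟨i, hi⟩ ∈ A := hmi.2 ⟨hc.1, not_lt.1 hc.2.1⟩
      refine ⟨⟨i, hi⟩, hiA, Nat.lt_succ_self i, by simp [NExp.val, hv], fun y hy hyi => ?_⟩
      rcases hb with ⟨hb, hnone⟩ | ⟨b, hbA, hbi, hb, hmin⟩
      · rcases Nat.lt_succ_iff_lt_or_eq.1 hyi with h | h
        · exact absurd h (hnone y hy)
        · exact (congrArg _ (Fin.ext h.symm)).le
      · rcases Nat.lt_succ_iff_lt_or_eq.1 hyi with h | h
        · refine le_trans ?_ (hmin y hy h)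
          have h3 := hc.2.2
          simp only [hb, b.isLt, hu₁, hu₂, true_and] at h3
          exact key_le_of_better h3
        · exact (congrArg _ (Fin.ext h.symm)).le
    · refine Runs.of_le (by simp) (Runs.skip ⟨hv, hr, fun a h1 h2 => by simp [h1, h2, hn], ?_⟩)
      simp only [Test.Holds, NExp.val, RExp.val, hv, e0, eF, r5, hiu₁, hiu₂] at hc
      rcases hb with ⟨hb, hnone⟩ | ⟨b, hbA, hbi, hb, hmin⟩
      · refine Or.inl ⟨by simpa using hb, fun y hy hyi => ?_⟩
        rcases Nat.lt_succ_iff_lt_or_eq.1 hyi with h | h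
        · exact hnone y hy h
        · have : y = ⟨i, hi⟩ := Fin.ext h
          subst this
          have := hmi.1 hy
          exact hc ⟨this.1, not_lt.2 this.2, by simp [hb]⟩
      · refine Or.inr ⟨b, hbA, by omega, by simpa using hb, fun y hy hyi => ?_⟩
        rcases Nat.lt_succ_iff_lt_or_eq.1 hyi with h | h
        · exact hmin y hy h
        · have : y = ⟨i, hi⟩ := Fin.ext h
          subst this
          have := hmi.1 hy
          simp only [hb, b.isLt, hu₁, hu₂, this.1, not_lt.2 this.2, not_false_eq_true,
            true_and] at hc
          exact key_le_of_not_better (Fin.le_def.2 hbi.le) (not_not.1 hc)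
  · rintro s' ⟨hr, hn, hb⟩ hv
    refine ⟨?_, fun a ha => ?_, fun a _ => by rw [hr]⟩
    swap
    · simp only [List.mem_cons, List.not_mem_nil, or_false, not_or] at ha
      exact hn a ha.1 ha.2
    rcases hb with ⟨-, hnone⟩ | ⟨b, hbA, -, hb, hmin⟩
    · obtain ⟨x, hx⟩ := hA
      exact absurd x.isLt (hnone x hx)
    · rw [hb, eq_worst hA hbA fun y hy => hmin y hy y.isLt]

/-! ### The subprograms -/

section Subprograms

variable {m : ℕ} {P : Fin m → Fin 2} {u₁ u₂ : Fin m → ℝ} {s : Store}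

/-- Injectivity of `g` keeps later writes from destroying earlier ones; `j` and `e` must keep their
meaning while `a` and the counter change. -/
theorem runs_fill {a : ℕ} {j e : NExp} {f g : ℕ → ℕ} (ha0 : a ≠ 0) (ha10 : a ≠ 10)
    (hm : s.nat 0 0 = m) (hg : g.Injective)
    (hj : ∀ s', Same [a, 10] [] s s' → j.val s' = g (s'.nat 10 0))
    (he : ∀ s', Same [a, 10] [] s s' → e.val s' = f (s'.nat 10 0)) :
    Runs (.forLoop 10 (.var 0) (.setNat a j e)) s (m * (j.cost + e.cost + 20) + 20) fun s' =>
      Same [a, 10] [] s s' ∧ (∀ i < m, s'.nat a (g i) = f i) ∧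
        ∀ x, (∀ i < m, g i ≠ x) → s'.nat a x = s.nat a x := by
  refine Runs.of_le ?_ (Runs.forLoop (n := m) (T := j.cost + e.cost + 1)
    (I := fun k s' => Same [a, 10] [] s s' ∧ (∀ i < k, s'.nat a (g i) = f i) ∧
        ∀ x, (∀ i < k, g i ≠ x) → s'.nat a x = s.nat a x) ?_ ?_ ?_ ?_)
  · simp only [NExp.cost]
    have : m * (j.cost + e.cost + 1 + (1 + 1) + 10) ≤ m * (j.cost + e.cost + 20) :=
      Nat.mul_le_mul_left _ (by omega)
    omega
  · exact ⟨(Same.refl _ _ _).putNat _ _ (by simp), by simp, by simp [ha10]⟩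
  · rintro i s' ⟨h, -, -⟩
    simp [NExp.val, h.1 0 (by simp [ha0.symm]), hm]
  · rintro i s' hi ⟨h, h1, h2⟩ hv
    refine Runs.setNat ?_
    rw [hj s' h, he s' h, hv]
    refine ⟨by simpa [ha10.symm] using hv,
      (h.putNat _ _ (by simp)).putNat _ _ (by simp), fun k hk => ?_, fun x hx => ?_⟩
    · rcases Nat.lt_succ_iff_lt_or_eq.1 hk with hk | rfl
      · have : g k ≠ g i := fun e => hk.ne (hg e)
        simp [ha10, this, h1 k hk]
      · simp [ha10]
    · have : x ≠ g i := fun e => hx i (Nat.lt_succ_self i) e.symm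
      simp only [ha10, ne_eq, not_false_eq_true, Store.putNat_nat_of_ne, Store.putNat_nat_self,
        Function.update_of_ne this]
      exact h2 x fun k hk => hx k (hk.trans (Nat.lt_succ_self i))
  · rintro s' h -
    exact h

/-- Put into the real variable `2` the utility that agent 1 gets by committing to the ranking in
array `5`.  Array `6` marks the items in the pool. -/
def evaluate : Prog :=
  .seq (.forLoop 10 (.var 0) (.setNat 6 (.var 10) (.lit 0))) <|
  .seq (.setRealVar 2 (.var 4)) <|
  .seq (.setRealVar 5 (.var 4)) <|
  .forLoop 15 (.var 0) <|
    .seq (.setNat 6 (.cell 5 (.var 15)) (.lit 1)) <|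
    .ite (.natLt (.cell 1 (.var 15)) (.lit 1))
      (.seq (scan 6) <| .seq (.setNat 6 (.var 13) (.lit 0)) <|
        .setRealVar 2 (.add (.var 2) (.cell 0 (.var 13))))
      .skip

/-- Variable `2` collects `u₁` of the expelled items, so collected utility plus pool equals prefix,
and the last prefix is everything. Real cell `4` supplies the constant zero, since the machine has
no real literals; the threshold zero in `scan` excludes nothing because `u₂` is positive. -/
theorem runs_evaluate (hs : Input P u₁ u₂ s) (hu₂ : ∀ o, 0 < u₂ o) {R : Ranking m}
    (hR : ∀ i : Fin m, s.nat 5 i = (R i : ℕ)) :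
    Runs evaluate s (m * (100 * m + 200) + 100 * m + 100) fun s' =>
      s'.real 2 0 = leaderValue P u₁ u₂ R ∧ Same [6, 10, 13, 14, 15] [2, 5] s s' := by
  have hfill := runs_fill (a := 6) (j := .var 10) (e := .lit 0) (f := fun _ => 0) (g := id)
    (s := s) (by decide) (by decide) hs.size Function.injective_id (fun _ _ => rfl)
    (fun _ _ => rfl)
  refine Runs.of_le ?_ (Runs.seq hfill fun s₁ h₁ => Runs.setReal_seq (Runs.setReal_seq
    (Runs.forLoop (n := m) (T := 100 * m + 140) (I := fun t s' =>
      Same [6, 10, 13, 14, 15] [2, 5] s s' ∧ s'.real 5 0 = 0 ∧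
      (∀ y : Fin m, s'.nat 6 y = if y ∈ poolSet P u₁ u₂ R t then 1 else 0) ∧
      s'.real 2 0 + utility u₁ (poolSet P u₁ u₂ R t) = utility u₁ (pref R t)) ?_ ?_ ?_ ?_)))
  · simp only [NExp.cost, RExp.cost]
    nlinarith
  · obtain ⟨hsame, h6, -⟩ := h₁
    have hz : s₁.real 4 0 = 0 := by rw [hsame.2 4 (by simp), hs.zero]
    refine ⟨?_, ?_, ?_, ?_⟩
    · refine (((Same.trans (Same.refl _ _ _) hsame ?_ ?_).putReal _ _ ?_).putReal _ _ ?_).putNat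
        _ _ ?_ <;> simp
    · simp [NExp.val, RExp.val, hz]
    · intro y
      simpa [poolSet] using h6 y y.isLt
    · simp [NExp.val, RExp.val, hz, poolSet, utility, pref]
  · rintro i s' ⟨h, -⟩
    simp [NExp.val, h.1 0 (by simp), hs.size]
  · rintro t s' ht ⟨h, h5, h6, h2⟩ hv
    have hi := hs.of_same h (by simp) (by simp)
    have hRt : s'.nat 5 t = (R ⟨t, ht⟩ : ℕ) := by
      rw [h.1 5 (by simp)]; exact hR ⟨t, ht⟩
    have hPt : s'.nat 1 t = (P ⟨t, ht⟩ : ℕ) := hi.turn ⟨t, ht⟩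
    set Q := insert (R ⟨t, ht⟩) (poolSet P u₁ u₂ R t) with hQ
    have hQne : Q.Nonempty := Finset.insert_nonempty _ _
    have hsumQ : utility u₁ Q = u₁ (R ⟨t, ht⟩) + utility u₁ (poolSet P u₁ u₂ R t) :=
      Finset.sum_insert (apply_notMem_poolSet ht)
    have hsump : utility u₁ (pref R (t + 1)) = u₁ (R ⟨t, ht⟩) + utility u₁ (pref R t) := by
      rw [pref_succ ht]
      exact Finset.sum_insert (apply_notMem_pref ht)
    refine Runs.of_le ?_ (Runs.setNat_seq (Runs.ite (T := 100 * m + 120) (fun hc => ?_)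
      fun hc => ?_))
    · simp only [NExp.cost, Test.cost]
      omega
    · simp only [NExp.val, hv, hRt] at hc ⊢
      have h6' : ∀ y : Fin m, (s'.putNat 6 (R ⟨t, ht⟩) 1).nat 6 y = if y ∈ Q then 1 else 0 := by
        intro y
        by_cases hy : y = R ⟨t, ht⟩
        · simp [hy, hQ]
        · have : (y : ℕ) ≠ (R ⟨t, ht⟩ : ℕ) := fun e => hy (Fin.ext e)
          simp [hQ, hy, this, h6]
      have hP0 : P ⟨t, ht⟩ = 0 := by
        simp [Test.Holds, NExp.val, hPt, hv] at hc
        exact hc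
      have hsame1 := h.putNat (a := 6) (R ⟨t, ht⟩) 1 (by simp)
      refine Runs.of_le ?_ (Runs.seq (runs_scan (hs.of_same hsame1 (by simp) (by simp))
        (by decide) (by decide) hQne ?_) fun s₂ h₂ => Runs.setNat_seq (Runs.setReal ?_))
      · simp only [NExp.cost, RExp.cost]
        omega
      · intro y
        rw [h6' y]
        have := (hu₂ y).le
        by_cases hy : y ∈ Q <;> simp [hy, h5, this]
      · obtain ⟨hw, hsame2⟩ := h₂
        have hi2 := (hs.of_same hsame1 (by simp) (by simp)).of_same hsame2 (by simp) (by simp)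
        set w := worst u₁ u₂ Q hQne with hwdef
        have hpool : poolSet P u₁ u₂ R (t + 1) = Q.erase w := by
          rw [poolSet, dif_pos ht, if_pos hP0]
        have hwQ : w ∈ Q := worst_mem Q hQne
        have e15 : s₂.nat 15 0 = t := by
          rw [hsame2.1 15 (by simp)]; simpa using hv
        have e5 : s₂.real 5 0 = 0 := by
          rw [hsame2.2 5 (by simp)]; simpa using h5
        have e2 : s₂.real 2 = s'.real 2 := by
          rw [hsame2.2 2 (by simp)]; simp
        have e0 : s₂.real 0 w = u₁ w := hi2.util₁ w
        have e6 : ∀ y : Fin m, s₂.nat 6 y = if y ∈ Q then 1 else 0 := by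
          rw [hsame2.1 6 (by simp)]; exact h6'
        simp only [NExp.val, RExp.val, hw]
        refine ⟨by simpa using e15, ?_, by simpa using e5, ?_, ?_⟩
        · exact (((hsame1.trans hsame2 (by simp) (by simp)).putNat _ _ (by simp)).putReal _ _
            (by simp)).putNat _ _ (by simp)
        · intro y
          rw [hpool]
          by_cases hy : y = w
          · simp [hy]
          · have : (y : ℕ) ≠ w := fun e => hy (Fin.ext e)
            simp [hy, this, e6]
        · rw [hpool]
          have hsw : u₁ w + utility u₁ (Q.erase w) = utility u₁ Q :=
            Finset.add_sum_erase Q u₁ hwQ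
          have : (s₂.putNat 6 w 0).nat 13 0 = w := by simpa using hw
          simp only [Store.putNat_real, Store.putReal_real_self, Function.update_self, this, e2, e0]
          linarith
    · simp only [NExp.val, hv, hRt] at hc ⊢
      have hP0 : P ⟨t, ht⟩ ≠ 0 := by
        intro h0
        simp [Test.Holds, NExp.val, hPt, hv, h0] at hc
      have hpool : poolSet P u₁ u₂ R (t + 1) = Q := by
        rw [poolSet, dif_pos ht, if_neg hP0]
      refine Runs.of_le (by omega) (Runs.skip ⟨by simpa using hv, ?_, by simpa using h5, ?_, ?_⟩)
      · exact (h.putNat _ _ (by simp)).putNat _ _ (by simp)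
      · intro y
        rw [hpool]
        by_cases hy : y = R ⟨t, ht⟩
        · simp [hy, hQ]
        · have : (y : ℕ) ≠ (R ⟨t, ht⟩ : ℕ) := fun e => hy (Fin.ext e)
          simp [hQ, hy, this, h6]
      · rw [hpool]
        simp only [Store.putNat_real]
        linarith
  · rintro s' ⟨h, -, -, h2⟩ -
    refine ⟨?_, h⟩
    rw [pref_self] at h2
    have := Finset.sum_compl_add_sum (poolSet P u₁ u₂ R m) u₁
    simp only [leaderValue, utility] at this h2 ⊢
    linarith

/-- Decode the list of items in array `3`, whose length is in variable `9`, into a ranking in array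
`5`.  Variable `12` is the number of items that have been placed, and array `4` marks the others. -/
def decodeProg : Prog :=
  .seq (.forLoop 10 (.var 0) (.setNat 4 (.var 10) (.lit 1))) <|
  .seq (.setVar 12 (.lit 0)) <|
  .forLoop 11 (.var 9) <|
    .loop (.natLt (.lit 0) (.cell 4 (.cell 3 (.var 11)))) <|
      .seq (.setRealVar 5 (.cell 1 (.cell 3 (.var 11)))) <|
      .seq (scan 4) <|
      .seq (.setNat 5 (.var 12) (.var 13)) <|
      .seq (.setNat 4 (.var 13) (.lit 0)) <|
      .setVar 12 (.add (.var 12) (.lit 1))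

/-- Array `5` holds the list `acc`, and array `4` marks the other items. -/
structure Holds (acc : List (Fin m)) (s : Store) : Prop where
  len : s.nat 12 0 = acc.length
  item : ∀ (i : ℕ) (h : i < acc.length), s.nat 5 i = (acc[i] : ℕ)
  mark : ∀ y : Fin m, s.nat 4 y = if y ∈ acc then 0 else 1

theorem Holds.of_same {acc : List (Fin m)} {s s' : Store} (h : Holds acc s) {N L : List ℕ}
    (hs : Same N L s s') (hN : 4 ∉ N ∧ 5 ∉ N ∧ 12 ∉ N) : Holds acc s' :=
  ⟨by rw [hs.1 12 hN.2.2, h.len], by rw [hs.1 5 hN.2.1]; exact h.item,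
    by rw [hs.1 4 hN.1]; exact h.mark⟩

theorem runs_decodeProg (hs : Input P u₁ u₂ s) {xs : List (Fin m)} (hlen : s.nat 9 0 = xs.length)
    (hxs : ∀ (i : ℕ) (h : i < xs.length), s.nat 3 i = (xs[i] : ℕ)) :
    Runs decodeProg s (xs.length * (m * (100 * m + 150) + 50) + 100 * m + 100) fun s' =>
      Holds (decode u₁ u₂ [] xs) s' ∧ Same [4, 5, 10, 11, 12, 13, 14] [5] s s' := by
  have hfill := runs_fill (a := 4) (j := .var 10) (e := .lit 1) (f := fun _ => 1) (g := id)
    (s := s) (by decide) (by decide) hs.size Function.injective_id (fun _ _ => rfl)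
    (fun _ _ => rfl)
  refine Runs.of_le ?_ (Runs.seq hfill fun s₁ h₁ => Runs.setNat_seq
    (Runs.forLoop (n := xs.length) (T := m * (100 * m + 150) + 10) (I := fun r s' =>
      Same [4, 5, 10, 11, 12, 13, 14] [5] s s' ∧ Holds (decode u₁ u₂ [] (xs.take r)) s')
      ?_ ?_ ?_ ?_))
  · simp only [NExp.cost]
    nlinarith
  · obtain ⟨hsame, h4, -⟩ := h₁
    refine ⟨?_, ?_, ?_, ?_⟩
    · refine ((Same.trans (Same.refl _ _ _) hsame ?_ ?_).putNat _ _ ?_).putNat _ _ ?_ <;> simp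
    · simp [NExp.val, decode]
    · simp [decode]
    · intro y
      simpa [decode] using h4 y y.isLt
  · rintro i s' ⟨h, -⟩
    simp [NExp.val, h.1 9 (by simp), hlen]
  · rintro r s' hr ⟨h, hacc⟩ hv
    set acc := decode u₁ u₂ [] (xs.take r) with haccdef
    have hnext : decode u₁ u₂ [] (xs.take (r + 1)) = extend u₁ u₂ acc xs[r] := by
      rw [List.take_succ_eq_append_getElem hr, decode_append]
      rfl
    have hx : ∀ s₂, Same [4, 5, 10, 11, 12, 13, 14] [5] s s₂ → s₂.nat 3 r = (xs[r] : ℕ) :=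
      fun s₂ h₂ => by rw [h₂.1 3 (by simp)]; exact hxs r hr
    -- Each round unfolds the recursion of `extend` once, so the result of extending the current
    -- list is invariant; the number of unplaced items bounds the rounds left.
    refine Runs.mono (Runs.loop (T := 100 * m + 140) (I := fun n s₂ =>
      Same [4, 5, 10, 11, 12, 13, 14] [5] s s₂ ∧ s₂.nat 11 0 = r ∧ ∃ acc', Holds acc' s₂ ∧
        extend u₁ u₂ acc' xs[r] = extend u₁ u₂ acc xs[r] ∧
        n = (Finset.univ.filter fun y => y ∉ acc').card) ?_
      (Finset.univ.filter fun y => y ∉ acc).card s' ⟨h, hv, acc, hacc, rfl, rfl⟩) ?_ ?_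
    · rintro n s₂ ⟨h₂, hv₂, acc', hacc', hext, rfl⟩ hc
      have hi := hs.of_same h₂ (by simp) (by simp)
      have hmem : xs[r] ∉ acc' := by
        intro hm
        simp [Test.Holds, NExp.val, hv₂, hx s₂ h₂, hacc'.mark, hm] at hc
      have hsame1 := h₂.putReal (a := 5) 0 (u₂ xs[r]) (by simp)
      have hi1 := hs.of_same hsame1 (by simp) (by simp)
      have hscan := runs_scan hi1 (F := 4) (by decide) (by decide)
        (A := Finset.univ.filter fun y => y ∉ acc' ∧ u₂ xs[r] ≤ u₂ y) ⟨xs[r], by simp [hmem]⟩ (by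
          intro y
          by_cases hy : y ∈ acc' <;> simp [hacc'.mark, hy])
      refine Runs.of_le ?_ (Runs.setReal_seq ?_) (T := 6 + (100 * m + 120))
      · omega
      · simp only [NExp.val, RExp.val, hv₂, hx s₂ h₂, hi.util₂]
        refine Runs.of_le ?_ (Runs.seq hscan fun s₃ h₃ => Runs.setNat_seq (Runs.setNat_seq
          (Runs.setNat ?_)))
        · simp only [NExp.cost]
          omega
        · obtain ⟨hw, hsame2⟩ := h₃
          change s₃.nat 13 0 = (pick u₁ u₂ acc' xs[r] hmem : ℕ) at hw
          have hlt := card_notMem_append_pick_lt (u₁ := u₁) (u₂ := u₂) hmem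
          have hextn := extend_of_notMem (u₁ := u₁) (u₂ := u₂) hmem
          set w := pick u₁ u₂ acc' xs[r] hmem with hwdef
          have hacc3 : Holds acc' s₃ := hacc'.of_same (N := [13, 14]) (L := [5])
            (((Same.refl _ _ _).putReal _ _ (by simp)).trans hsame2 (by simp) (by simp)) (by simp)
          refine ⟨_, hlt, ?_, ?_, acc' ++ [w], ⟨?_, ?_, ?_⟩, ?_, rfl⟩
          · exact ((((hsame1.trans hsame2 (by simp) (by simp)).putNat _ _ (by simp)).putNat _ _
              (by simp)).putNat _ _ (by simp))
          · have : s₃.nat 11 0 = r := by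
              rw [hsame2.1 11 (by simp)]; simpa using hv₂
            simpa using this
          · simp [NExp.val, hacc3.len]
          · intro i hi
            simp only [NExp.val, hacc3.len, hw]
            rw [List.length_append, List.length_singleton] at hi
            rcases Nat.lt_succ_iff_lt_or_eq.1 hi with hi' | rfl
            · simp [hi'.ne, List.getElem_append_left hi', hacc3.item i hi']
            · simp
          · intro y
            simp only [NExp.val, hacc3.len, hw]
            by_cases hy : y = w
            · simp [hy, hw]
            · have : (y : ℕ) ≠ w := fun e => hy (Fin.ext e)
              simp [hy, hw, this, hacc3.mark]
          · rw [← hextn, hext]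
    · have hle : (Finset.univ.filter fun y => y ∉ acc).card ≤ m := by
        simpa using Finset.card_le_univ (Finset.univ.filter fun y => y ∉ acc)
      simp only [Test.cost, NExp.cost]
      have := Nat.mul_le_mul_right (1 + (1 + 1 + 1 + 1) + 1 + (100 * m + 140)) hle
      nlinarith
    · rintro s₂ ⟨n, -, ⟨h₂, hv₂, acc', hacc', hext, -⟩, hc⟩
      have hmem : xs[r] ∈ acc' := by
        by_contra hm
        simp [Test.Holds, NExp.val, hv₂, hx s₂ h₂, hacc'.mark, hm] at hc
      refine ⟨hv₂, h₂.putNat _ _ (by simp), ?_⟩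
      rw [hnext, ← hext, extend_of_mem hmem]
      exact hacc'.of_same ((Same.refl [11] [] _).putNat _ _ (by simp)) (by simp)
  · rintro s' ⟨h, hacc⟩ -
    rw [List.take_length] at hacc
    exact ⟨hacc, h⟩

end Subprograms

/-! ### Enumeration of the lists and the main program -/

/-- Keep the ranking in array `5` as output if its value, in the real variable `2`, is at least the
best one so far, in the real variable `3`. -/
def update : Prog :=
  .ite (.neg (.realLt (.var 2) (.var 3)))
    (.seq (.setRealVar 3 (.var 2)) (.forLoop 10 (.var 0) (.setNat 2 (.var 10) (.cell 5 (.var 10)))))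
    .skip

/-- Replace the number whose digits are the first cells of array `3`, as many as variable `8` says, by
its successor; set variable `16` to `1` if this is not possible. -/
def next : Prog :=
  .seq (.setVar 17 (.lit 0)) <|
  .seq (.loop (.conj (.natLt (.var 17) (.var 8))
      (.neg (.natLt (.add (.cell 3 (.var 17)) (.lit 1)) (.var 0)))) <|
    .seq (.setNat 3 (.var 17) (.lit 0)) (.setVar 17 (.add (.var 17) (.lit 1)))) <|
  .ite (.natLt (.var 17) (.var 8))
    (.setNat 3 (.var 17) (.add (.cell 3 (.var 17)) (.lit 1)))
    (.setVar 16 (.lit 1))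

/-- Put into variable `7` the number of distinct utilities of agent 2. -/
def countValues : Prog :=
  .forLoop 10 (.var 0) <|
    .seq (.setVar 18 (.lit 0)) <|
    .seq (.forLoop 14 (.var 10) <|
      .ite (.conj (.neg (.realLt (.cell 1 (.var 10)) (.cell 1 (.var 14))))
          (.neg (.realLt (.cell 1 (.var 14)) (.cell 1 (.var 10)))))
        (.setVar 18 (.lit 1)) .skip) <|
    .ite (.natLt (.var 18) (.lit 1)) (.setVar 7 (.add (.var 7) (.lit 1))) .skip

/-- Put into variable `8` the number `k * (k + 1)` of digits, where `k` is the value of variable `7`,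
and prepare array `3`: after the digits follow all items. -/
def prepare : Prog :=
  .seq (.forLoop 10 (.var 7) (.setVar 8 (.add (.var 8) (.add (.var 7) (.lit 1))))) <|
  .seq (.setVar 9 (.add (.var 8) (.var 0))) <|
  .forLoop 10 (.var 0) (.setNat 3 (.add (.var 8) (.var 10)) (.var 10))

/-- The program that computes an optimal commitment. -/
def stackelberg : Prog :=
  .seq countValues <| .seq prepare <|
  .loop (.natLt (.var 16) (.lit 1)) <| .seq decodeProg <| .seq evaluate <| .seq update next

section Main

variable {m : ℕ} {P : Fin m → Fin 2} {u₁ u₂ : Fin m → ℝ} {s : Store}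

theorem runs_update (hs : Input P u₁ u₂ s) {R : Ranking m} (hR : ∀ i : Fin m, s.nat 5 i = (R i : ℕ)) :
    Runs update s (m * 30 + 40) fun s' => Same [2, 10] [3] s s' ∧
      s'.real 3 0 = max (s.real 2 0) (s.real 3 0) ∧
      ((s.real 3 0 ≤ s.real 2 0 ∧ Outputs s' R) ∨ (s.real 2 0 < s.real 3 0 ∧ s'.nat 2 = s.nat 2)) := by
  refine Runs.of_le ?_ (Runs.ite (T := m * 30 + 30) (fun hc => ?_) fun hc => ?_)
  · simp only [Test.cost, RExp.cost, NExp.cost]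
    omega
  · have hle : s.real 3 0 ≤ s.real 2 0 := by
      simpa [Test.Holds, RExp.val, NExp.val] using hc
    refine Runs.of_le ?_ (Runs.setReal_seq (Runs.mono (runs_fill (m := m) (a := 2) (j := .var 10)
      (e := .cell 5 (.var 10)) (f := s.nat 5) (g := id) (by decide) (by decide)
      (by simpa using hs.size) Function.injective_id (fun _ _ => rfl) ?_) le_rfl ?_))
    · simp only [NExp.cost, RExp.cost]
      omega
    · intro s' h
      simp [NExp.val, h.1 5 (by simp)]
    · rintro s' ⟨h, h2, -⟩
      refine ⟨((Same.refl _ _ _).putReal _ _ (by simp)).trans h (by simp) (by simp), ?_,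
        Or.inl ⟨hle, fun p => ?_⟩⟩
      · rw [h.2 3 (by simp), max_eq_left hle]
        simp [NExp.val, RExp.val]
      · exact (h2 p p.isLt).trans (hR p)
  · have hlt : s.real 2 0 < s.real 3 0 := by
      simpa [Test.Holds, RExp.val, NExp.val] using hc
    exact Runs.of_le (by omega)
      (Runs.skip ⟨Same.refl _ _ _, (max_eq_right hlt.le).symm, Or.inr ⟨hlt, rfl⟩⟩)

/-- An odometer with the lowest digit first: the loop resets digits `m - 1` to `0`. The carry has
passed `j` digits exactly when `m ^ j` divides `v + 1`, and a carry past all `D` digits means `v + 1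
= m ^ D`. -/
theorem runs_next {D v : ℕ} (hm : s.nat 0 0 = m) (hD : s.nat 8 0 = D) (hv : v < m ^ D)
    (h16 : s.nat 16 0 = 0) (hdig : ∀ i < D, s.nat 3 i = v / m ^ i % m) :
    Runs next s (D * 40 + 60) fun s' => Same [3, 16, 17] [] s s' ∧
      (∀ i, D ≤ i → s'.nat 3 i = s.nat 3 i) ∧
      ((v + 1 < m ^ D ∧ s'.nat 16 0 = 0 ∧ ∀ i < D, s'.nat 3 i = (v + 1) / m ^ i % m) ∨
        (v + 1 = m ^ D ∧ s'.nat 16 0 = 1)) := by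
  have hm0 : 0 < D → 0 < m := fun hD => by
    rcases Nat.eq_zero_or_pos m with rfl | h
    · rw [zero_pow hD.ne'] at hv
      omega
    · exact h
  -- If `v + 1 = m ^ j * c`, the digits of `v` from place `j` on are those of `c - 1`.
  have hpred : ∀ j c, v + 1 = m ^ j * c → 0 < m → v / m ^ j = c - 1 := by
    intro j c hc hm
    have hp : 0 < m ^ j := Nat.pow_pos hm
    rcases c with _ | c
    · omega
    · have : v = m ^ j * c + (m ^ j - 1) := by
        rw [Nat.mul_succ] at hc
        omega
      rw [this, Nat.mul_add_div hp, Nat.div_eq_of_lt (by omega)]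
      rfl
  refine Runs.of_le ?_ (Runs.setNat_seq (Runs.seq (Runs.loop (T := 15) (I := fun n s' =>
    Same [3, 16, 17] [] s s' ∧ s'.nat 16 0 = 0 ∧ ∃ j, n + j = D ∧ s'.nat 17 0 = j ∧ m ^ j ∣ v + 1 ∧
      (∀ i < j, s'.nat 3 i = 0) ∧ ∀ i, j ≤ i → s'.nat 3 i = s.nat 3 i) ?_ D _ ?_) ?_)) (T := _ + (_ + 30))
  · simp only [Test.cost, NExp.cost]
    omega
  · rintro n s' ⟨h, h16', j, hnj, hj, ⟨c, hc⟩, hz, hrest⟩ hb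
    have e8 : s'.nat 8 0 = D := by rw [h.1 8 (by simp), hD]
    have e0 : s'.nat 0 0 = m := by rw [h.1 0 (by simp), hm]
    simp only [Test.Holds, NExp.val, hj, e8, e0, hrest j le_rfl, not_lt] at hb
    obtain ⟨hjD, hge⟩ := hb
    have hmp := hm0 (by omega)
    rw [hdig j hjD, hpred j c hc hmp] at hge
    have hc0 : c ≠ 0 := by
      rintro rfl
      omega
    have hmod : (c - 1) % m = m - 1 := by
      have := Nat.mod_lt (c - 1) hmp
      omega
    have hdvd : m ∣ c := by
      have h1 := Nat.div_add_mod (c - 1) m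
      refine ⟨(c - 1) / m + 1, ?_⟩
      rw [Nat.mul_succ]
      omega
    refine Runs.of_le ?_ (Runs.setNat_seq (Runs.setNat ?_))
    · simp [NExp.cost]
    · simp only [NExp.val, hj]
      refine ⟨n - 1, by omega, (h.putNat _ _ (by simp)).putNat _ _ (by simp), by simpa using h16',
        j + 1, by omega, by simp [hj], ?_, fun i hi => ?_, fun i hi => ?_⟩
      · rw [hc, pow_succ]
        exact Nat.mul_dvd_mul_left _ hdvd
      · rcases Nat.lt_succ_iff_lt_or_eq.1 hi with hi | rfl
        · simp [hi.ne, hz i hi]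
        · simp
      · have hij : i ≠ j := by omega
        simp [hij, hrest i (by omega)]
  · exact ⟨(Same.refl _ _ _).putNat _ _ (by simp), by simpa using h16, 0, by omega,
      by simp [NExp.val], by simp, by simp, by simp⟩
  · rintro s' ⟨n, -, ⟨h, h16', j, hnj, hj, ⟨c, hc⟩, hz, hrest⟩, hb⟩
    have e8 : s'.nat 8 0 = D := by rw [h.1 8 (by simp), hD]
    have e0 : s'.nat 0 0 = m := by rw [h.1 0 (by simp), hm]
    refine Runs.of_le ?_ (Runs.ite (T := 10) (fun hjD => ?_) fun hjD => ?_)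
    · simp [Test.cost, NExp.cost]
    · simp only [Test.Holds, NExp.val, hj, e8] at hjD
      simp only [Test.Holds, NExp.val, hj, e8, e0, hrest j le_rfl, not_and, not_not] at hb
      have hlt := hb hjD
      have hmp := hm0 (by omega)
      have hq := hpred j c hc hmp
      have hc0 : c ≠ 0 := by
        rintro rfl
        omega
      obtain ⟨q, rfl⟩ := Nat.exists_eq_succ_of_ne_zero hc0
      have hq : v / m ^ j = q := hq
      rw [hdig j hjD, hq] at hlt
      have hmod : (q + 1) % m = q % m + 1 := by
        rw [Nat.add_mod, Nat.mod_eq_of_lt (a := 1) (by omega), Nat.mod_eq_of_lt hlt]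
      have hdiv : (q + 1) / m = q / m := by
        have h1 := Nat.div_add_mod q m
        have : q + 1 = m * (q / m) + (q % m + 1) := by omega
        rw [this, Nat.mul_add_div hmp, Nat.div_eq_of_lt hlt]
        rfl
      have hpos : 0 < m ^ j := Nat.pow_pos hmp
      refine Runs.of_le ?_ (Runs.setNat ?_)
      · simp [NExp.cost]
      simp only [NExp.val, hj, hrest j le_rfl]
      refine ⟨h.putNat _ _ (by simp), fun i hi => ?_, Or.inl ⟨?_, by simpa using h16',
        fun i hi => ?_⟩⟩
      · have : i ≠ j := by omega
        simp [this, hrest i (by omega)]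
      -- If `v + 1` were `m ^ D`, then `m` would divide `q + 1`, so digit `j` would be `m - 1` and
      -- the carry loop would not have stopped.
      · refine lt_of_le_of_ne hv fun heq => ?_
        rw [hc, show D = j + (D - j - 1 + 1) by omega, pow_add] at heq
        have h1 := Nat.eq_of_mul_eq_mul_left hpos heq
        rw [pow_succ] at h1
        have h2 : (q + 1) % m = 0 := by
          change q.succ % m = 0
          rw [h1, Nat.mul_mod_left]
        omega
      · rcases lt_trichotomy i j with hij | rfl | hij
        · simp only [Store.putNat_nat_self, Function.update_of_ne hij.ne, hz i hij]
          rw [hc, show j = i + 1 + (j - (i + 1)) by omega, pow_add, pow_succ, mul_assoc, mul_assoc,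
            Nat.mul_div_cancel_left _ (Nat.pow_pos hmp), Nat.mul_mod_right]
        · simp only [Store.putNat_nat_self, Function.update_self]
          rw [hc, Nat.mul_div_cancel_left _ hpos, hdig i hi, hq]
          exact hmod.symm
        · simp only [Store.putNat_nat_self, Function.update_of_ne hij.ne', hrest i hij.le]
          rw [hdig i hi, show i = j + (1 + (i - j - 1)) by omega, pow_add, pow_add,
            ← Nat.div_div_eq_div_mul, ← Nat.div_div_eq_div_mul, ← Nat.div_div_eq_div_mul,
            ← Nat.div_div_eq_div_mul, hc, Nat.mul_div_cancel_left _ hpos, hq, pow_one]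
          change _ = (q + 1) / m / _ % m
          rw [hdiv]
    · simp only [Test.Holds, NExp.val, hj, e8] at hjD
      have : j = D := by omega
      subst this
      refine Runs.of_le ?_ (Runs.setNat ?_)
      · simp [NExp.cost]
      refine ⟨h.putNat _ _ (by simp), fun i hi => by simp [hrest i hi], Or.inr ⟨?_, by simp [NExp.val]⟩⟩
      exact le_antisymm hv (Nat.le_of_dvd (Nat.succ_pos v) ⟨c, hc⟩)

theorem runs_countValues (hs : Input P u₁ u₂ s) (h7 : s.nat 7 0 = 0) :
    Runs countValues s (m * (m * 40 + 80) + 20) fun s' =>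
      Same [7, 10, 14, 18] [] s s' ∧ s'.nat 7 0 = (Finset.univ.image u₂).card := by
  refine Runs.of_le ?_ (Runs.forLoop (n := m) (T := m * 40 + 60) (I := fun i s' =>
    Same [7, 10, 14, 18] [] s s' ∧
      s'.nat 7 0 = ((Finset.univ.filter fun x : Fin m => (x : ℕ) < i).image u₂).card) ?_ ?_ ?_ ?_)
  · simp only [NExp.cost]
    nlinarith
  · exact ⟨(Same.refl _ _ _).putNat _ _ (by simp), by simpa using h7⟩
  · rintro i s' ⟨h, -⟩
    simp [NExp.val, h.1 0 (by simp), hs.size]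
  · rintro i s' hi ⟨h, hk⟩ hv
    refine Runs.of_le ?_ (Runs.setNat_seq (Runs.seq (Runs.forLoop (n := i) (T := 25)
      (I := fun j s₂ => Same [7, 10, 14, 18] [] s s₂ ∧ s₂.nat 7 0 = s'.nat 7 0 ∧ s₂.nat 10 0 = i ∧
        (s₂.nat 18 0 = 0 ∧ (∀ x : Fin m, (x : ℕ) < j → u₂ x ≠ u₂ ⟨i, hi⟩) ∨
          s₂.nat 18 0 = 1 ∧ ∃ x : Fin m, (x : ℕ) < i ∧ u₂ x = u₂ ⟨i, hi⟩))
      ?_ ?_ ?_ fun s h _ => h) ?_)) (T := _ + (_ + 15))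
    · simp only [NExp.cost]
      nlinarith
    · exact ⟨(h.putNat _ _ (by simp)).putNat _ _ (by simp), by simp, by simpa using hv,
        Or.inl ⟨by simp [NExp.val], by simp⟩⟩
    · rintro j s₂ ⟨-, -, h10, -⟩
      simpa [NExp.val] using h10
    · rintro j s₂ hj ⟨h₂, h7', h10, h18⟩ hv₂
      have hin := hs.of_same h₂ (by simp) (by simp)
      have ei : s₂.real 1 i = u₂ ⟨i, hi⟩ := hin.util₂ ⟨i, hi⟩
      have ej : s₂.real 1 j = u₂ ⟨j, hj.trans hi⟩ := hin.util₂ ⟨j, hj.trans hi⟩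
      refine Runs.of_le ?_ (Runs.ite (T := 4) (fun hc => ?_) fun hc => ?_)
      · simp [Test.cost, RExp.cost, NExp.cost]
      · simp only [Test.Holds, RExp.val, NExp.val, h10, hv₂, ei, ej, not_lt] at hc
        refine Runs.of_le ?_ (Runs.setNat ?_)
        · simp [NExp.cost]
        · exact ⟨by simpa using hv₂, (h₂.putNat _ _ (by simp)).putNat _ _ (by simp),
            by simpa using h7', by simpa using h10, Or.inr ⟨by simp [NExp.val],
              ⟨j, hj.trans hi⟩, hj, le_antisymm hc.1 hc.2⟩⟩
      · simp only [Test.Holds, RExp.val, NExp.val, h10, hv₂, ei, ej, not_lt] at hc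
        refine Runs.of_le (by omega) (Runs.skip ⟨hv₂, h₂.putNat _ _ (by simp), by simpa using h7',
          by simpa using h10, ?_⟩)
        rcases h18 with ⟨h18, hno⟩ | h18
        · refine Or.inl ⟨by simpa using h18, fun x hx he => ?_⟩
          rcases Nat.lt_succ_iff_lt_or_eq.1 hx with hx | hx
          · exact hno x hx he
          · have : x = ⟨j, hj.trans hi⟩ := Fin.ext hx
            subst this
            exact hc ⟨he.le, he.ge⟩
        · exact Or.inr (by simpa using h18)
    · rintro s₂ ⟨h₂, h7', h10, h18⟩
      have hfil : (Finset.univ.filter fun x : Fin m => (x : ℕ) < i + 1) =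
          insert ⟨i, hi⟩ (Finset.univ.filter fun x : Fin m => (x : ℕ) < i) := by
        ext x
        simp only [Finset.mem_filter, Finset.mem_univ, true_and, Finset.mem_insert, Fin.ext_iff]
        omega
      refine Runs.of_le ?_ (Runs.ite (T := 7) (fun hc => ?_) fun hc => ?_)
      · simp [Test.cost, NExp.cost]
      · have hno : ∀ x : Fin m, (x : ℕ) < i → u₂ x ≠ u₂ ⟨i, hi⟩ := by
          rcases h18 with h18 | h18
          · exact h18.2
          · simp [Test.Holds, NExp.val, h18.1] at hc
        refine Runs.of_le ?_ (Runs.setNat ?_)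
        · simp [NExp.cost]
        · refine ⟨by simpa using h10, (h₂.putNat _ _ (by simp)).putNat _ _ (by simp), ?_⟩
          rw [hfil, Finset.image_insert, Finset.card_insert_of_notMem, ← hk, ← h7']
          · simp [NExp.val]
          · simp only [Finset.mem_image, Finset.mem_filter, Finset.mem_univ, true_and, not_exists,
              not_and]
            exact hno
      · have hyes : ∃ x : Fin m, (x : ℕ) < i ∧ u₂ x = u₂ ⟨i, hi⟩ := by
          rcases h18 with h18 | h18
          · simp [Test.Holds, NExp.val, h18.1] at hc
          · exact h18.2
        refine Runs.of_le (by omega) (Runs.skip ⟨h10, h₂.putNat _ _ (by simp), ?_⟩)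
        rw [hfil, Finset.image_insert, Finset.insert_eq_of_mem, ← hk, ← h7']
        · simp
        · simpa using hyes
  · rintro s' ⟨h, hk⟩ -
    refine ⟨h, hk.trans ?_⟩
    congr 2
    ext x
    simp

/-- The product `k * (k + 1)` is formed by `k` additions, because multiplication is not a machine
operation. -/
theorem runs_prepare {k : ℕ} (hm : s.nat 0 0 = m) (h7 : s.nat 7 0 = k) (h8 : s.nat 8 0 = 0)
    (h3 : ∀ i, s.nat 3 i = 0) :
    Runs prepare s (k * 30 + m * 30 + 60) fun s' =>
      Same [3, 8, 9, 10] [] s s' ∧ s'.nat 8 0 = k * (k + 1) ∧ s'.nat 9 0 = k * (k + 1) + m ∧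
        (∀ i < k * (k + 1), s'.nat 3 i = 0) ∧ ∀ i < m, s'.nat 3 (k * (k + 1) + i) = i := by
  refine Runs.of_le ?_ (Runs.seq (Runs.forLoop (n := k) (T := 12) (I := fun i s' =>
    Same [3, 8, 9, 10] [] s s' ∧ s'.nat 8 0 = i * (k + 1) ∧ s'.nat 3 = s.nat 3) ?_ ?_ ?_
    fun s h _ => h) fun s₁ h₁ => Runs.setNat_seq ?_) (T := _ + (_ + (m * 30 + 20)))
  · simp only [NExp.cost]
    omega
  · exact ⟨(Same.refl _ _ _).putNat _ _ (by simp), by simpa using h8, by simp⟩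
  · rintro i s' ⟨h, -⟩
    simp [NExp.val, h.1 7 (by simp), h7]
  · rintro i s' hi ⟨h, h8', h3'⟩ hv
    have e7 : s'.nat 7 0 = k := by rw [h.1 7 (by simp), h7]
    refine Runs.of_le ?_ (Runs.setNat ?_)
    · simp [NExp.cost]
    · refine ⟨by simpa using hv, (h.putNat _ _ (by simp)).putNat _ _ (by simp), ?_, by simpa using h3'⟩
      simp [NExp.val, h8', e7]
      ring
  · obtain ⟨h, h8', h3'⟩ := h₁
    have e0 : s₁.nat 0 0 = m := by rw [h.1 0 (by simp), hm]
    have hfill := runs_fill (m := m) (a := 3) (j := .add (.var 8) (.var 10)) (e := .var 10)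
      (f := id) (g := fun i => k * (k + 1) + i)
      (s := s₁.putNat 9 ((NExp.lit 0).val s₁) ((NExp.add (.var 8) (.var 0)).val s₁))
      (by decide) (by decide) (by simpa using e0) (fun a b h => by simpa using h)
      (fun s' h => by simp [NExp.val, h.1 8 (by simp), h8']) (fun _ _ => rfl)
    refine Runs.mono hfill ?_ ?_
    · simp only [NExp.cost]
      omega
    · rintro s' ⟨hsame, hin, hout⟩
      refine ⟨(h.putNat _ _ (by simp)).trans hsame (by simp) (by simp), ?_, ?_, fun i hi => ?_, hin⟩
      · rw [hsame.1 8 (by simp)]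
        simpa using h8'
      · rw [hsame.1 9 (by simp)]
        simp [NExp.val, h8', e0]
      · rw [hout i fun j _ => by omega]
        simp [h3', h3]

/-! ### Correctness and running time of the main loop -/

/-- The digits of `v` in base `m`. -/
theorem finFunctionFinEquiv_symm_val {D v : ℕ} (hv : v < m ^ D) (i : Fin D) :
    ((finFunctionFinEquiv.symm (⟨v, hv⟩ : Fin (m ^ D)) i : Fin m) : ℕ) = v / m ^ (i : ℕ) % m := rfl

/-- After `v` rounds of the main loop, the output is the best of the first `v` rankings. -/
structure Progress (P : Fin m → Fin 2) (u₁ u₂ : Fin m → ℝ) (D v : ℕ) (s : Store) : Prop where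
  input : Input P u₁ u₂ s
  digits : s.nat 8 0 = D
  length : s.nat 9 0 = D + m
  items : ∀ i < m, s.nat 3 (D + i) = i
  le : v ≤ m ^ D
  best : ∀ (w : ℕ) (hw : w < m ^ D), w < v →
    leaderValue P u₁ u₂ (ranking u₁ u₂ (List.ofFn (finFunctionFinEquiv.symm ⟨w, hw⟩)))
      ≤ s.real 3 0
  start : v = 0 → s.real 3 0 = 0
  output : 0 < v → ∃ R : Ranking m, Outputs s R ∧ leaderValue P u₁ u₂ R = s.real 3 0
  state : (v < m ^ D ∧ s.nat 16 0 = 0 ∧ ∀ i < D, s.nat 3 i = v / m ^ i % m) ∨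
    (v = m ^ D ∧ s.nat 16 0 = 1)

theorem leaderValue_nonneg (hu₁ : ∀ o, 0 < u₁ o) (R : Ranking m) : 0 ≤ leaderValue P u₁ u₂ R :=
  Finset.sum_nonneg fun o _ => (hu₁ o).le

theorem runs_round (hu₁ : ∀ o, 0 < u₁ o) (hu₂ : ∀ o, 0 < u₂ o) {D v : ℕ}
    (hp : Progress P u₁ u₂ D v s) (hv : v < m ^ D) :
    Runs (.seq decodeProg <| .seq evaluate <| .seq update next) s
      ((D + m) * (m * (100 * m + 150) + 50) + m * (100 * m + 500) + D * 40 + 300)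
      (Progress P u₁ u₂ D (v + 1)) := by
  obtain ⟨h16, hdig⟩ : s.nat 16 0 = 0 ∧ ∀ i < D, s.nat 3 i = v / m ^ i % m := by
    rcases hp.state with h | h
    · exact h.2
    · omega
  set f : Fin D → Fin m := finFunctionFinEquiv.symm ⟨v, hv⟩ with hf
  set R := ranking u₁ u₂ (List.ofFn f) with hRdef
  have hlen : (List.ofFn f ++ List.finRange m).length = D + m := by simp
  have hdec := runs_decodeProg (u₁ := u₁) (u₂ := u₂) hp.input (xs := List.ofFn f ++ List.finRange m)
    (by rw [hlen, hp.length]) (by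
      intro i hi
      rw [hlen] at hi
      by_cases hiD : i < D
      · rw [hdig i hiD, List.getElem_append_left (by simpa using hiD), List.getElem_ofFn, hf,
          finFunctionFinEquiv_symm_val]
      · obtain ⟨j, rfl⟩ := Nat.exists_eq_add_of_le (not_lt.1 hiD)
        rw [hp.items j (by omega), List.getElem_append_right (by simp)]
        simp)
  rw [← ofFn_ranking, ← hRdef] at hdec
  have hR : ∀ s', Holds (List.ofFn R) s' → ∀ i : Fin m, s'.nat 5 i = (R i : ℕ) := by
    intro s' h i
    rw [h.item i (by simp)]
    simp
  refine Runs.of_le ?_ (Runs.seq hdec fun s₁ h₁ => Runs.seq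
    (runs_evaluate (hp.input.of_same h₁.2 (by simp) (by simp)) hu₂ (hR s₁ h₁.1)) fun s₂ h₂ =>
    Runs.seq (runs_update ((hp.input.of_same h₁.2 (by simp) (by simp)).of_same h₂.2 (by simp)
      (by simp)) (R := R) ?_) fun s₃ h₃ =>
    Runs.mono (runs_next (m := m) (D := D) (v := v) ?_ ?_ hv ?_ ?_) le_rfl ?_)
  · rw [hlen]
    nlinarith
  · intro i
    rw [h₂.2.1 5 (by simp)]
    exact hR s₁ h₁.1 i
  · rw [h₃.1.1 0 (by simp), h₂.2.1 0 (by simp), h₁.2.1 0 (by simp), hp.input.size]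
  · rw [h₃.1.1 8 (by simp), h₂.2.1 8 (by simp), h₁.2.1 8 (by simp), hp.digits]
  · rw [h₃.1.1 16 (by simp), h₂.2.1 16 (by simp), h₁.2.1 16 (by simp), h16]
  · rw [h₃.1.1 3 (by simp), h₂.2.1 3 (by simp), h₁.2.1 3 (by simp)]
    exact hdig
  · rintro s₄ ⟨h₄, hrest, hstate⟩
    have hsame : Same [2, 3, 4, 5, 6, 10, 11, 12, 13, 14, 15, 16, 17] [2, 3, 5] s s₄ :=
      ((((Same.refl _ _ _).trans h₁.2 (by simp) (by simp)).trans h₂.2 (by simp) (by simp)).trans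
        h₃.1 (by simp) (by simp)).trans h₄ (by simp) (by simp)
    have e3 : s₂.real 3 0 = s.real 3 0 := by rw [h₂.2.2 3 (by simp), h₁.2.2 3 (by simp)]
    have e3' : s₄.real 3 0 = max (leaderValue P u₁ u₂ R) (s.real 3 0) := by
      rw [h₄.2 3 (by simp), h₃.2.1, h₂.1, e3]
    have e2 : s₄.nat 2 = s₃.nat 2 := h₄.1 2 (by simp)
    refine ⟨hp.input.of_same hsame (by simp) (by simp), by rw [hsame.1 8 (by simp), hp.digits],
      by rw [hsame.1 9 (by simp), hp.length], fun i hi => ?_, hv, fun w hw hwv => ?_, by simp,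
      fun _ => ?_, hstate⟩
    · rw [hrest _ (by omega), h₃.1.1 3 (by simp), h₂.2.1 3 (by simp), h₁.2.1 3 (by simp)]
      exact hp.items i hi
    · rw [e3']
      rcases Nat.lt_succ_iff_lt_or_eq.1 hwv with h | rfl
      · exact (hp.best w hw h).trans (le_max_right _ _)
      · exact le_max_left _ _
    · rw [e3']
      rw [h₂.1, e3] at h₃
      rcases h₃.2.2 with ⟨hle, hout⟩ | ⟨hlt, hout⟩
      · exact ⟨R, fun p => by rw [e2]; exact hout p, (max_eq_left hle).symm⟩
      -- The first ranking cannot be rejected: the best value starts at `0`, leader values are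
      -- nonnegative, and `update` accepts ties. So an earlier output exists.
      · have hv0 : 0 < v := by
          rcases Nat.eq_zero_or_pos v with h0 | h0
          · rw [hp.start h0] at hlt
            exact absurd (leaderValue_nonneg hu₁ R) (not_le.2 hlt)
          · exact h0
        obtain ⟨R', hR', hval⟩ := hp.output hv0
        refine ⟨R', fun p => ?_, hval.trans (max_eq_right hlt.le).symm⟩
        rw [e2, hout, h₂.2.1 2 (by simp), h₁.2.1 2 (by simp)]
        exact hR' p

theorem input_inputStore (P : Fin m → Fin 2) (u₁ u₂ : Fin m → ℝ) :
    Input P u₁ u₂ (inputStore P u₁ u₂) := by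
  constructor <;> simp [inputStore]

/-- A bound for the number of steps, for `m` items and `k` distinct utilities of agent 2. -/
def timeBound (m k : ℕ) : ℕ :=
  m * (m * 40 + 80) + 20 + (k * 30 + m * 30 + 60 + ((m + 1) ^ (k * (k + 1)) * (10 +
    ((k * (k + 1) + m) * (m * (100 * m + 150) + 50) + m * (100 * m + 500) + k * (k + 1) * 40 + 300))
      + 10))

/-- The base `m + 1` in `timeBound`, in place of `m`, is needed here: powers of `0` are not monotone
in the exponent. -/
theorem timeBound_mono (m : ℕ) : Monotone (timeBound m) := by
  intro k k' h
  unfold timeBound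
  have h1 : k * (k + 1) ≤ k' * (k' + 1) := Nat.mul_le_mul h (by omega)
  have h2 : (m + 1) ^ (k * (k + 1)) ≤ (m + 1) ^ (k' * (k' + 1)) :=
    Nat.pow_le_pow_right (by omega) h1
  gcongr

theorem runs_stackelberg (hu₁ : ∀ o, 0 < u₁ o) (hu₂ : ∀ o, 0 < u₂ o) :
    Runs stackelberg (inputStore P u₁ u₂) (timeBound m (Finset.univ.image u₂).card) fun s =>
      ∃ R, Outputs s R ∧ IsOptimalCommitment P u₁ u₂ R := by
  set k := (Finset.univ.image u₂).card with hk
  set D := k * (k + 1) with hD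
  have hin := input_inputStore P u₁ u₂
  have hz : ∀ a j, 2 ≤ a → (inputStore P u₁ u₂).nat a j = 0 := by
    intro a j ha
    have h0 : a ≠ 0 := by omega
    have h1 : a ≠ 1 := by omega
    simp [inputStore, h0, h1]
  have hr3 : (inputStore P u₁ u₂).real 3 0 = 0 := by simp [inputStore]
  -- Without items there are no values, so `D = 0` and `0 ^ 0 = 1`: the empty list is still tried,
  -- so the main loop always runs at least once.
  have hpos : 0 < m ^ D := by
    rcases Nat.eq_zero_or_pos m with rfl | h
    · simp [hD, hk]
    · exact Nat.pow_pos h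
  refine Runs.of_le ?_ (Runs.seq (runs_countValues hin (hz _ _ (by simp))) fun s₁ h₁ =>
    Runs.seq (runs_prepare (m := m) (k := k) ?_ h₁.2 ?_ ?_) fun s₂ h₂ =>
    Runs.mono (Runs.loop (T := (D + m) * (m * (100 * m + 150) + 50) + m * (100 * m + 500) + D * 40 + 300)
      (I := fun n s => ∃ v, n + v = m ^ D ∧ Progress P u₁ u₂ D v s) ?_ (m ^ D) s₂
        ⟨0, rfl, ?_⟩) le_rfl ?_)
  · simp only [timeBound, Test.cost, NExp.cost, ← hD]
    have h1 : m ^ D ≤ (m + 1) ^ D := Nat.pow_le_pow_left (by omega) D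
    gcongr <;> omega
  · rw [h₁.1.1 0 (by simp), hin.size]
  · rw [h₁.1.1 8 (by simp), hz _ _ (by simp)]
  · intro i
    rw [h₁.1.1 3 (by simp), hz _ _ (by simp)]
  · rintro n s ⟨v, hn, hp⟩ hb
    rcases hp.state with h | h
    · exact Runs.mono (runs_round hu₁ hu₂ hp h.1) le_rfl
        fun s' hs' => ⟨n - 1, by omega, v + 1, by omega, hs'⟩
    · simp [Test.Holds, NExp.val, h.2] at hb
  · obtain ⟨hsame, h8, h9, hdig, hitems⟩ := h₂
    have hsame' : Same [3, 7, 8, 9, 10, 14, 18] [] (inputStore P u₁ u₂) s₂ :=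
      ((Same.refl _ _ _).trans h₁.1 (by simp) (by simp)).trans hsame (by simp) (by simp)
    refine ⟨hin.of_same hsame' (by simp) (by simp), h8, h9, hitems, Nat.zero_le _, by simp,
      fun _ => ?_, by simp, Or.inl ⟨hpos, ?_, fun i hi => ?_⟩⟩
    · rw [hsame'.2 3 (by simp), hr3]
    · rw [hsame'.1 16 (by simp), hz _ _ (by simp)]
    · rw [hdig i hi]
      simp
  · rintro s ⟨n, -, ⟨v, -, hp⟩, hb⟩
    have hv : v = m ^ D := by
      rcases hp.state with h | h
      · simp [Test.Holds, NExp.val, h.2.1] at hb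
      · exact h.1
    obtain ⟨R, hout, hval⟩ := hp.output (hv ▸ hpos)
    refine ⟨R, hout, isOptimalCommitment_iff.2 fun R' => ?_⟩
    -- Any competitor `R'` is matched by some code `f`, and the number with the digits `f` was among
    -- the rounds of the loop.
    obtain ⟨f, hf⟩ := exists_leaderValue_le_ranking (P := P) (u₁ := u₁) (u₂ := u₂) R' hD
    refine hf.trans ?_
    rw [hval]
    have := hp.best (finFunctionFinEquiv f) (finFunctionFinEquiv f).isLt
      (hv ▸ (finFunctionFinEquiv f).isLt)
    rwa [Fin.eta, Equiv.symm_apply_apply] at this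

end Main

end SeqAlloc

theorem mainTheorem3 :
    ∃ prog : SeqAlloc.Prog, ∀ k : ℕ, ∃ q : Polynomial ℕ,
      ∀ (m : ℕ) (P : Fin m → Fin 2) (u₁ u₂ : Fin m → ℝ),
        (∀ o, 0 < u₁ o) → (∀ o, 0 < u₂ o) → (Set.range u₂).ncard ≤ k →
        ∃ (t : ℕ) (s : SeqAlloc.Store) (R : SeqAlloc.Ranking m),
          SeqAlloc.Exec prog (SeqAlloc.inputStore P u₁ u₂) t s ∧ t ≤ q.eval m ∧
            SeqAlloc.Outputs s R ∧ SeqAlloc.IsOptimalCommitment P u₁ u₂ R := by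
  refine ⟨SeqAlloc.stackelberg, fun k => ?_⟩
  -- For fixed `k` the exponent `k * (k + 1)` is a constant, so `timeBound` is literally a
  -- polynomial in `m`.
  obtain ⟨q, hq⟩ : ∃ q : Polynomial ℕ, ∀ m, q.eval m = SeqAlloc.timeBound m k := by
    refine ⟨.X * (.X * 40 + 80) + 20 + (.C k * 30 + .X * 30 + 60 + ((.X + 1) ^ (k * (k + 1)) * (10 +
      ((.C (k * (k + 1)) + .X) * (.X * (100 * .X + 150) + 50) + .X * (100 * .X + 500) +
        .C (k * (k + 1)) * 40 + 300)) + 10)), fun m => ?_⟩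
    simp [SeqAlloc.timeBound]
  refine ⟨q, fun m P u₁ u₂ hu₁ hu₂ hk => ?_⟩
  obtain ⟨t, s, hexec, ht, R, hout, hopt⟩ := SeqAlloc.runs_stackelberg (P := P) hu₁ hu₂
  refine ⟨t, s, R, hexec, ht.trans ?_, hout, hopt⟩
  rw [hq]
  refine SeqAlloc.timeBound_mono m ?_
  rwa [← Set.ncard_coe_finset, Finset.coe_image, Finset.coe_univ, Set.image_univ]
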